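/- Let $(\overline M,\overline g)$ be a smooth semi-Riemannian manifold (of constant index) with Levi-Civita connection $\overline\nabla$, of constant sectional curvature $c$, and let $M$ be a smooth (immersed) hypersurface of $\overline M$ that is lightlike: the induced metric $g$ has a radical $\mathrm{Rad}\,T_pM=\{v\in T_pM: g(v,w)=0\ \forall w\in T_pM\}$ of dimension one at every $p\in M$. Let $u\in M$. A *screen distribution* $S(TM)$ is a smooth distribution on $M$ with $TM=\mathrm{Rad}\,TM\oplus S(TM)$. At each point, for $0\neq\xi\in\mathrm{Rad}\,T_pM$, it determines a unique null vector $N\in T_p\overline M$ with $\overline g(N,\xi)=1$ and $N\perp S(T_pM)$. These vectors $N$ span the transversal line bundle $\mathrm{ltr}(TM)$, and $T\overline M|_M=TM\oplus\mathrm{ltr}(TM)$. The induced connection $\nabla_XY$ is the $TM$-component of $\overline\nabla_XY$, $R(X,Y)Z=\nabla_X\nabla_YZ-\nabla_Y\nabla_XZ-\nabla_{[X,Y]}Z$ is its curvature, $R(x,y,z,w)=g(R(x,y)z,w)$, and $\mathrm{Ric}(x,y)=\mathrm{trace}(z\mapsto R(x,z)y)$. The screen distribution is *admissible* if at every point of $M$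 $$R(x,y,z,w)=-R(y,x,z,w)=R(z,w,x,y),\qquad R(x,y,z,w)+R(y,z,x,w)+R(z,x,y,w)=0 .$$ For an admissible screen distribution let $\tilde g=g+\eta\otimes\eta$ with $\eta=\overline g(N,\cdot)$. This is nondegenerate on $T_uM$. The pseudo-Jacobi operator $J_R(x):T_uM\to T_uM$ is defined by $\tilde g(J_R(x)y,w)=R(y,x,x,w)$; it does not depend on the choice of $\xi$. Put $S_u^{\pm}(M)=\{x\in T_uM: g(x,x)=\pm1\}$. $M$ is *spacelike* (resp. *timelike*) *Osserman at $u$* if for every admissible screen distribution the characteristic polynomial of $J_R(x)$ is the same for all $x\in S_u^+(M)$ (resp. $x\in S_u^-(M)$). $M$ is *Osserman at $u$* if it is spacelike Osserman at $u$ and $S_u^+(M)\neq\emptyset$, or timelike Osserman at $u$ and $S_u^-(M)\neq\emptyset$, or if $S_u^+(M)=S_u^-(M)=\emptyset$ (i.e. $\dim M=1$). **Statement.** If $M$ is Osserman at $u$, then for every admissible screen distribution $S(TM)$ the hypersurface $(M,g,S(TM))$ is Einstein at $u$: there is $\lambda\in\mathbb R$ with $\mathrm{Ric}(x,y)=\lambda\,g(x,y)$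 for all $x,y\in T_uM$. -/

import Mathlib

open scoped Manifold ContDiff Topology
open Module

noncomputable section

namespace LightlikeGeometry

/-! ### Bilinear forms and algebraic curvature tensors -/

section Algebra

variable {V W : Type*} [AddCommGroup V] [Module ℝ V] [TopologicalSpace V]
  [AddCommGroup W] [Module ℝ W] [TopologicalSpace W]

/-- The pullback `(w, w') ↦ b (A w) (A w')` of a bilinear form `b` along a linear map `A`. -/
def pullbackForm (b : V →L[ℝ] V →L[ℝ] ℝ) (A : W →L[ℝ] V) : W →L[ℝ] W →L[ℝ] ℝ :=
  (ContinuousLinearMap.precomp ℝ A) ∘L b ∘L A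

@[simp]
theorem pullbackForm_apply (b : V →L[ℝ] V →L[ℝ] ℝ) (A : W →L[ℝ] V) (w w' : W) :
    pullbackForm b A w w' = b (A w) (A w') := rfl

/-- `ν` is the index of the form `b`: the largest dimension of a subspace on which `b` is negative
definite. -/
def HasIndex (b : V →L[ℝ] V →L[ℝ] ℝ) (ν : ℕ) : Prop :=
  IsGreatest {k : ℕ | ∃ U : Submodule ℝ V, finrank ℝ U = k ∧ ∀ w ∈ U, w ≠ 0 → b w w < 0} ν

/-- The radical `{v | b v w = 0 for all w}` of a bilinear form. -/
def radical (b : V →L[ℝ] V →L[ℝ] ℝ) : Submodule ℝ V := LinearMap.ker (b : V →ₗ[ℝ] V →L[ℝ] ℝ)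

/-- An algebraic curvature tensor on a vector space. -/
structure IsAlgebraicCurvature (T : V → V → V → V → ℝ) : Prop where
  skew : ∀ x y z w, T x y z w = -T y x z w
  pair_symm : ∀ x y z w, T x y z w = T z w x y
  bianchi : ∀ x y z w, T x y z w + T y z x w + T z x y w = 0

end Algebra

/-! ### Christoffel symbols and curvature in coordinates -/

section Coordinates

variable {F : Type*} [NormedAddCommGroup F] [NormedSpace ℝ F]

set_option maxSynthPendingDepth 4 in
/-- The `(0,3)`-tensor `½ (∂_v G(w, z) + ∂_w G(v, z) - ∂_z G(v, w))` of Christoffel symbols of the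
first kind of a metric `G` given in coordinates. -/
def christoffelLower (G : F → F →L[ℝ] F →L[ℝ] ℝ) (y : F) : F →L[ℝ] F →L[ℝ] F →L[ℝ] ℝ :=
  let D : F →L[ℝ] F →L[ℝ] F →L[ℝ] ℝ := fderiv ℝ G y
  let T : (F →L[ℝ] F →L[ℝ] ℝ) →L[ℝ] F →L[ℝ] F →L[ℝ] ℝ :=
    (ContinuousLinearMap.flipₗᵢ ℝ F F ℝ).toContinuousLinearEquiv
  let D' : F →L[ℝ] F →L[ℝ] F →L[ℝ] ℝ := T ∘L D.flip
  (1 / 2 : ℝ) • (D + D.flip - D')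

set_option maxSynthPendingDepth 4 in
theorem christoffelLower_apply (G : F → F →L[ℝ] F →L[ℝ] ℝ) (y v w z : F) :
    christoffelLower G y v w z =
      (1 / 2) * (fderiv ℝ G y v w z + fderiv ℝ G y w v z - fderiv ℝ G y z v w) := rfl

/-- The Christoffel symbols `Γ(v, w)` of the Levi-Civita connection of a metric `G` given in
coordinates, `G(Γ(v, w), z) = ½ (∂_v G(w, z) + ∂_w G(v, z) - ∂_z G(v, w))`; the Levi-Civita
connection is `∇_v W = ∂_v W + Γ(v, W)`. -/
def christoffel (G : F → F →L[ℝ] F →L[ℝ] ℝ) (y : F) : F →L[ℝ] F →L[ℝ] F :=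
  (ContinuousLinearMap.compL ℝ F (F →L[ℝ] ℝ) F (G y).inverse) ∘L christoffelLower G y

theorem christoffel_apply (G : F → F →L[ℝ] F →L[ℝ] ℝ) (y v w : F) :
    christoffel G y v w = (G y).inverse (christoffelLower G y v w) := rfl

/-- The curvature `R(v, w)z = ∇_v ∇_w z - ∇_w ∇_v z - ∇_[v, w] z` at `x` of the linear connection
`∇_v Z = ∂_v Z + Γ(v, Z)` given in coordinates. -/
def curvature (Γ : F → F →L[ℝ] F →L[ℝ] F) (x : F) : F →L[ℝ] F →L[ℝ] F →L[ℝ] F :=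
  let D : F →L[ℝ] F →L[ℝ] F →L[ℝ] F := fderiv ℝ Γ x
  let Q : F →L[ℝ] F →L[ℝ] F →L[ℝ] F := (ContinuousLinearMap.compL ℝ F F F).bilinearComp (Γ x) (Γ x)
  D - D.flip + (Q - Q.flip)

theorem curvature_apply (Γ : F → F →L[ℝ] F →L[ℝ] F) (x v w z : F) :
    curvature Γ x v w z = fderiv ℝ Γ x v w z - fderiv ℝ Γ x w v z
      + (Γ x v (Γ x w z) - Γ x w (Γ x v z)) := rfl

end Coordinates

/-! ### Semi-Riemannian manifolds -/

section Ambient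

variable {F : Type*} [NormedAddCommGroup F] [NormedSpace ℝ F]
  {N : Type*} [TopologicalSpace N] [ChartedSpace F N]

/-- The expression of a field `g` of bilinear forms in the preferred chart at `q`. -/
def metricInChart
    (g : ∀ q : N, TangentSpace 𝓘(ℝ, F) q →L[ℝ] TangentSpace 𝓘(ℝ, F) q →L[ℝ] ℝ) (q : N) (y : F) :
    F →L[ℝ] F →L[ℝ] ℝ :=
  pullbackForm (g ((chartAt F q).symm y)) (mfderiv 𝓘(ℝ, F) 𝓘(ℝ, F) (chartAt F q).symm y)

variable (F N) in
/-- A semi-Riemannian metric: a smooth field of symmetric nondegenerate bilinear forms of constant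
index on the tangent spaces. -/
structure SemiRiemannianMetric where
  form : ∀ q : N, TangentSpace 𝓘(ℝ, F) q →L[ℝ] TangentSpace 𝓘(ℝ, F) q →L[ℝ] ℝ
  symm : ∀ q v w, form q v w = form q w v
  nondegenerate : ∀ q v, (∀ w, form q v w = 0) → v = 0
  constant_index : ∃ ν : ℕ, ∀ q, HasIndex (form q) ν
  smooth : ∀ q, ContDiffOn ℝ ∞ (metricInChart form q) (chartAt F q).target

namespace SemiRiemannianMetric

variable (g : SemiRiemannianMetric F N)

/-- The Riemann curvature `R(x, y)z` of the Levi-Civita connection, as a tensor on the tangent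
space at `q`. It is computed in the preferred chart at `q`, which identifies the tangent space at
`q` with the model space `F`. -/
def riemann (q : N) :
    TangentSpace 𝓘(ℝ, F) q →L[ℝ] TangentSpace 𝓘(ℝ, F) q →L[ℝ] TangentSpace 𝓘(ℝ, F) q →L[ℝ]
      TangentSpace 𝓘(ℝ, F) q :=
  (curvature (christoffel (metricInChart g.form q)) (chartAt F q q) : F →L[ℝ] F →L[ℝ] F →L[ℝ] F)

/-- The sectional curvature of the plane spanned by `v` and `w` (meaningful if the plane is
nondegenerate, i.e. if the denominator does not vanish). -/
def sectionalCurvature (q : N) (v w : TangentSpace 𝓘(ℝ, F) q) : ℝ :=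
  g.form q (g.riemann q v w w) v / (g.form q v v * g.form q w w - g.form q v w ^ 2)

/-- All nondegenerate tangent planes have sectional curvature `c`. -/
def HasConstantSectionalCurvature (c : ℝ) : Prop :=
  ∀ (q : N) (v w : TangentSpace 𝓘(ℝ, F) q),
    g.form q v v * g.form q w w - g.form q v w ^ 2 ≠ 0 → g.sectionalCurvature q v w = c

end SemiRiemannianMetric

end Ambient

/-! ### Lightlike hypersurfaces -/

section Hypersurface

variable {E : Type*} [NormedAddCommGroup E] [NormedSpace ℝ E]
  {F : Type*} [NormedAddCommGroup F] [NormedSpace ℝ F]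
  {M : Type*} [TopologicalSpace M] [ChartedSpace E M] [IsManifold 𝓘(ℝ, E) ∞ M]
  {N : Type*} [TopologicalSpace N] [ChartedSpace F N]
  (g : SemiRiemannianMetric F N) (f : M → N)

/-- The metric on `M` induced by `f : M → N`. -/
def inducedMetric (p : M) : TangentSpace 𝓘(ℝ, E) p →L[ℝ] TangentSpace 𝓘(ℝ, E) p →L[ℝ] ℝ :=
  pullbackForm (g.form (f p)) (mfderiv 𝓘(ℝ, E) 𝓘(ℝ, F) f p)

/-- `f` is an immersion of `M` as a hypersurface of `N` whose induced metric is degenerate with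
radical of rank one at every point, i.e. `M` is a lightlike hypersurface of `N`. -/
structure IsLightlikeHypersurface : Prop where
  codimension_one : finrank ℝ F = finrank ℝ E + 1
  smooth : ContMDiff 𝓘(ℝ, E) 𝓘(ℝ, F) ∞ f
  immersive : ∀ p : M, Function.Injective (mfderiv 𝓘(ℝ, E) 𝓘(ℝ, F) f p)
  finrank_radical : ∀ p : M, finrank ℝ (radical (inducedMetric (E := E) g f p)) = 1

/-- A screen distribution: a smooth distribution complementary to the radical distribution.
(It is automatically orthogonal to the radical, and the induced metric is nondegenerate on it.) -/
structure ScreenDistribution where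
  space : ∀ p : M, Submodule ℝ (TangentSpace 𝓘(ℝ, E) p)
  isCompl : ∀ p, IsCompl (radical (inducedMetric (E := E) g f p)) (space p)
  smooth : ∀ p : M, ∃ U : Set M, IsOpen U ∧ p ∈ U ∧
    ∃ (k : ℕ) (X : Fin k → ∀ q : M, TangentSpace 𝓘(ℝ, E) q),
      (∀ i, ContMDiffOn 𝓘(ℝ, E) 𝓘(ℝ, E).tangent ∞
        (fun q => (⟨q, X i q⟩ : TangentBundle 𝓘(ℝ, E) M)) U) ∧
      ∀ q ∈ U, LinearIndependent ℝ (fun i => X i q) ∧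
        space q = Submodule.span ℝ (Set.range fun i => X i q)

namespace ScreenDistribution

variable {g f} (S : ScreenDistribution (E := E) g f)

/-- `(ξ, n)` is a normalizing pair at `p`: `ξ` spans the radical and `n` is the null vector of the
ambient tangent space orthogonal to the screen with `g(n, ξ) = 1`. -/
structure IsNormalizingPair (p : M) (ξ : TangentSpace 𝓘(ℝ, E) p)
    (n : TangentSpace 𝓘(ℝ, F) (f p)) : Prop where
  mem_radical : ξ ∈ radical (inducedMetric (E := E) g f p)
  null : g.form (f p) n n = 0
  orthogonal : ∀ s ∈ S.space p, g.form (f p) n (mfderiv 𝓘(ℝ, E) 𝓘(ℝ, F) f p s) = 0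
  normalized : g.form (f p) n (mfderiv 𝓘(ℝ, E) 𝓘(ℝ, F) f p ξ) = 1

/-- The fibre at `p` of the lightlike transversal line bundle `ltr(TM)` of the screen. -/
def ltr (p : M) : Submodule ℝ (TangentSpace 𝓘(ℝ, F) (f p)) :=
  Submodule.span ℝ {n | ∃ ξ, S.IsNormalizingPair p ξ n}

/-- The projection of the ambient tangent space onto the tangent space of `M` along `ltr(TM)`:
the unique linear map that is a left inverse of the differential of `f` and vanishes on `ltr(TM)`.
-/
def tangentialProjection (p : M) :
    TangentSpace 𝓘(ℝ, F) (f p) →L[ℝ] TangentSpace 𝓘(ℝ, E) p :=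
  Classical.epsilon fun τ =>
    (∀ v, τ (mfderiv 𝓘(ℝ, E) 𝓘(ℝ, F) f p v) = v) ∧ ∀ n ∈ S.ltr p, τ n = 0

/-- The map `f` in the preferred charts at `p` and `f p`. -/
def mapInChart (f : M → N) (p : M) (x : E) : F := chartAt F (f p) (f ((chartAt E p).symm x))

/-- The tangential projection in the preferred charts at `p` and `f p`. -/
def tangentialProjectionInChart (p : M) (x : E) : F →L[ℝ] E :=
  let q : M := (chartAt E p).symm x
  (mfderiv 𝓘(ℝ, E) 𝓘(ℝ, E) (chartAt E p) q : TangentSpace 𝓘(ℝ, E) q →L[ℝ] E) ∘L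
    S.tangentialProjection q ∘L
    (mfderiv 𝓘(ℝ, F) 𝓘(ℝ, F) (chartAt F (f p)) (f q) :
      TangentSpace 𝓘(ℝ, F) (f q) →L[ℝ] F).inverse

/-- The connection coefficients, in the preferred charts at `p` and `f p`, of the connection `∇`
induced on `M` by the screen: for coordinate vector fields `v`, `w` on `M`, `∇_v w` is the
tangential part of the ambient Levi-Civita derivative
`∂_v ∂_w f + Γ(∂_v f, ∂_w f)` of `df(w)` along `f`. -/
def inducedChristoffel (p : M) (x : E) : E →L[ℝ] E →L[ℝ] E :=
  (ContinuousLinearMap.compL ℝ E F E (S.tangentialProjectionInChart p x)) ∘L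
    (fderiv ℝ (fderiv ℝ (mapInChart f p)) x +
      (christoffel (metricInChart g.form (f p)) (mapInChart f p x)).bilinearComp
        (fderiv ℝ (mapInChart f p) x) (fderiv ℝ (mapInChart f p) x))

/-- The curvature `R(x, y)z` of the induced connection, as a tensor on the tangent space at `p`. -/
def inducedCurvature (p : M) :
    TangentSpace 𝓘(ℝ, E) p →L[ℝ] TangentSpace 𝓘(ℝ, E) p →L[ℝ] TangentSpace 𝓘(ℝ, E) p →L[ℝ]
      TangentSpace 𝓘(ℝ, E) p :=
  (curvature (S.inducedChristoffel p) (chartAt E p p) : E →L[ℝ] E →L[ℝ] E →L[ℝ] E)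

/-- The induced `(0,4)`-curvature `R(x, y, z, w) = g(R(x, y)z, w)`. -/
def inducedCurvature₄ (p : M) (x y z w : TangentSpace 𝓘(ℝ, E) p) : ℝ :=
  inducedMetric (E := E) g f p (S.inducedCurvature p x y z) w

/-- The screen is admissible if its induced curvature is an algebraic curvature tensor at every
point. -/
def IsAdmissible : Prop := ∀ p : M, IsAlgebraicCurvature (S.inducedCurvature₄ p)

/-- The induced Ricci tensor `Ric(x, y) = trace (z ↦ R(x, z)y)`. -/
def ricci (p : M) (x y : TangentSpace 𝓘(ℝ, E) p) : ℝ :=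
  let R : E →L[ℝ] E →L[ℝ] E →L[ℝ] E := S.inducedCurvature p
  LinearMap.trace ℝ E ((R x).flip y : E →L[ℝ] E)

/-- `(M, g, S(TM))` is Einstein at `p`. -/
def IsEinsteinAt (p : M) : Prop :=
  ∃ l : ℝ, ∀ x y, S.ricci p x y = l * inducedMetric (E := E) g f p x y

/-- The nondegenerate metric `g̃ = g + η ⊗ η` at `p`, where `η = g(n, ·)` for the null transversal
vector `n` of a normalizing pair. -/
def associatedMetric (p : M) (n : TangentSpace 𝓘(ℝ, F) (f p)) :
    TangentSpace 𝓘(ℝ, E) p →L[ℝ] TangentSpace 𝓘(ℝ, E) p →L[ℝ] ℝ :=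
  let η : TangentSpace 𝓘(ℝ, E) p →L[ℝ] ℝ := g.form (f p) n ∘L mfderiv 𝓘(ℝ, E) 𝓘(ℝ, F) f p
  inducedMetric (E := E) g f p + η.smulRight η

/-- The pseudo-Jacobi operator `J(x)` at `p`, given by `g̃(J(x)y, w) = R(y, x, x, w)`. -/
def pseudoJacobi (p : M) (n : TangentSpace 𝓘(ℝ, F) (f p)) (x : TangentSpace 𝓘(ℝ, E) p) :
    E →ₗ[ℝ] E :=
  let R : E →L[ℝ] E →L[ℝ] E →L[ℝ] E := S.inducedCurvature p
  let b : E →L[ℝ] E →L[ℝ] ℝ := inducedMetric (E := E) g f p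
  let b' : E →L[ℝ] E →L[ℝ] ℝ := associatedMetric (g := g) p n
  (b'.inverse ∘L b ∘L ((R.flip x).flip x) : E →L[ℝ] E)

end ScreenDistribution

/-- The pseudo-sphere `{x | g(x, x) = ε}` in the tangent space of `M` at `p`. -/
def pseudoSphere (p : M) (ε : ℝ) : Set (TangentSpace 𝓘(ℝ, E) p) :=
  {x | inducedMetric (E := E) g f p x x = ε}

/-- For every admissible screen, the characteristic polynomial of `J(x)` does not depend on
`x` in the pseudo-sphere of radius `ε`: spacelike Osserman at `p` for `ε = 1`, timelike Osserman at
`p` for `ε = -1`. (`J(x)` does not depend on the normalizing pair.) -/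
def IsOssermanOn [FiniteDimensional ℝ E] (p : M) (ε : ℝ) : Prop :=
  ∀ S : ScreenDistribution (E := E) g f, S.IsAdmissible → ∀ ξ n, S.IsNormalizingPair p ξ n →
    ∀ x ∈ pseudoSphere (E := E) g f p ε, ∀ y ∈ pseudoSphere (E := E) g f p ε,
      (S.pseudoJacobi p n x).charpoly = (S.pseudoJacobi p n y).charpoly

/-- Osserman at `p`: spacelike or timelike Osserman at `p`, where a causal type counts only if
unit vectors of this type exist; no condition if there are no unit vectors at all. -/
def IsOssermanAt [FiniteDimensional ℝ E] (p : M) : Prop :=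
  ((pseudoSphere (E := E) g f p 1).Nonempty ∧ IsOssermanOn (E := E) g f p 1) ∨
  ((pseudoSphere (E := E) g f p (-1)).Nonempty ∧ IsOssermanOn (E := E) g f p (-1)) ∨
  (pseudoSphere (E := E) g f p 1 = ∅ ∧ pseudoSphere (E := E) g f p (-1) = ∅)

end Hypersurface

end LightlikeGeometry

end

/-! Write `P` for the projection of `TM` onto the screen along the radical; it equals `g̃⁻¹ ∘ g`.
Since `v = P v + η(v) ξ`, the trace defining the Ricci tensor splits as `Ric(x, y) = tr (z ↦ P R(x,
z) y) + η(R(x, ξ) y)`, and each summand is a multiple of `g` (`trace_ricci_eq`, `exists_ricci_eq`).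

The first summand is a bilinear form `q`, symmetric because pair symmetry of the curvature makes the
operators for `(x, y)` and `(y, x)` adjoint with respect to `g̃` (`trace_screenRicciOperator_symm`).
On the diagonal, `q(x, x) = -tr J(x)`. The Osserman condition fixes this trace on a nonempty
pseudo-sphere, and a quadratic form constant on a nonempty pseudo-sphere of `g` is a multiple of `g`
(`eq_mul_of_constant_on_pseudosphere`).

The second summand is a component of the ambient curvature. Ambient and induced derivatives differ
by multiples of `N`, and `∇̄N ⊥ N` because `N` is null, so the curvatures have the same pairing with
`N` (`gauss_equation`, `form_inducedCurvature`). Constant curvature then gives `η(R(x, ξ) y) = -c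
g(x, y)`.

If there are no unit vectors, then `g = 0`, so `dim M = 1` and the curvature vanishes. Most of the
remaining work shows that the null transversal field, and hence the induced connection, is
differentiable in charts. -/

noncomputable section

namespace LightlikeGeometry

/-! ### Levi-Civita connection and curvature symmetries in coordinates. -/

section LeviCivita

variable {F : Type*} [NormedAddCommGroup F] [NormedSpace ℝ F]
  {G : F → F →L[ℝ] F →L[ℝ] ℝ} {y : F}

theorem minSmoothness_two_le : minSmoothness ℝ 2 ≤ ∞ := by
  rw [minSmoothness_of_isRCLikeNormedField]
  exact WithTop.coe_le_coe.2 (le_top (a := (2 : ℕ∞)))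

theorem fderiv_form_symm (hG : DifferentiableAt ℝ G y)
    (hs : ∀ᶠ y' in 𝓝 y, ∀ v w, G y' v w = G y' w v) (z v w : F) :
    fderiv ℝ G y z v w = fderiv ℝ G y z w v := by
  have h1 := (hG.hasFDerivAt.clm_apply (hasFDerivAt_const v y)).clm_apply (hasFDerivAt_const w y)
  have h2 := (hG.hasFDerivAt.clm_apply (hasFDerivAt_const w y)).clm_apply (hasFDerivAt_const v y)
  have h3 := h1.congr_of_eventuallyEq (f₁ := fun x => G x w v) (by
    filter_upwards [hs] with x hx using hx _ _)
  have := congrArg (fun L : F →L[ℝ] ℝ => L z) (h2.unique h3)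
  simpa using this.symm

theorem christoffel_symm (hG : DifferentiableAt ℝ G y)
    (hs : ∀ᶠ y' in 𝓝 y, ∀ v w, G y' v w = G y' w v) (v w : F) :
    christoffel G y v w = christoffel G y w v := by
  rw [christoffel_apply, christoffel_apply]
  congr 1
  ext z
  rw [christoffelLower_apply, christoffelLower_apply, fderiv_form_symm hG hs z v w]
  ring

/-- Invertibility matters: `ContinuousLinearMap.inverse` is zero on non-invertible maps. -/
theorem form_christoffel (hi : (G y).IsInvertible) (v w z : F) :
    G y (christoffel G y v w) z = christoffelLower G y v w z := by
  rw [christoffel_apply, ← (hi.inverse_apply_eq (x := (G y).inverse _)).1 rfl]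

/-- The Levi-Civita connection is compatible with the metric. -/
theorem fderiv_form_eq (hG : DifferentiableAt ℝ G y)
    (hs : ∀ᶠ y' in 𝓝 y, ∀ v w, G y' v w = G y' w v) (hi : (G y).IsInvertible) (v w z : F) :
    fderiv ℝ G y v w z = G y (christoffel G y v w) z + G y w (christoffel G y v z) := by
  rw [hs.self_of_nhds w, form_christoffel hi, form_christoffel hi, christoffelLower_apply,
    christoffelLower_apply, fderiv_form_symm hG hs v z w, fderiv_form_symm hG hs z v w,
    fderiv_form_symm hG hs w v z]
  ring

theorem differentiableAt_fderiv_of_contDiffAt {E : Type*} [NormedAddCommGroup E] [NormedSpace ℝ E]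
    {φ : E → F} {x : E} (h : ContDiffAt ℝ ∞ φ x) : DifferentiableAt ℝ (fderiv ℝ φ) x :=
  (h.fderiv_right (m := ∞) (by simp)).differentiableAt (by simp)

theorem eventually_differentiableAt_of_contDiffAt {E : Type*} [NormedAddCommGroup E]
    [NormedSpace ℝ E] {φ : E → F} {x : E} (h : ContDiffAt ℝ ∞ φ x) :
    ∀ᶠ x' in 𝓝 x, DifferentiableAt ℝ φ x' := by
  have h1 : ContDiffAt ℝ 1 φ x := h.of_le (by exact_mod_cast le_top)
  filter_upwards [h1.eventually (by simp)] with x' hx' using hx'.differentiableAt (by simp)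

theorem eventually_isInvertible {E : Type*} [NormedAddCommGroup E] [NormedSpace ℝ E]
    [CompleteSpace E] {X : Type*} [TopologicalSpace X] {A : X → E →L[ℝ] F} {x : X}
    (hA : ContinuousAt A x) (hi : (A x).IsInvertible) : ∀ᶠ x' in 𝓝 x, (A x').IsInvertible := by
  obtain ⟨e, he⟩ := hi
  have := ContinuousLinearEquiv.nhds e
  rw [he] at this
  exact hA this

set_option maxSynthPendingDepth 4 in
theorem differentiableAt_christoffel [CompleteSpace F] (hG : ContDiffAt ℝ ∞ G y)
    (hi : (G y).IsInvertible) : DifferentiableAt ℝ (christoffel G) y := by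
  have h1 : DifferentiableAt ℝ (fun y => (G y).inverse) y :=
    ((hi.contDiffAt_map_inverse (n := ∞)).differentiableAt (by simp)).comp y
      (hG.differentiableAt (by simp))
  have h2 : DifferentiableAt ℝ (fderiv ℝ G) y := differentiableAt_fderiv_of_contDiffAt hG
  have h3 : DifferentiableAt ℝ (christoffelLower G) y := by
    have hf : DifferentiableAt ℝ (fun y => (fderiv ℝ G y).flip) y :=
      (ContinuousLinearMap.flipₗᵢ ℝ F F (F →L[ℝ] ℝ)).toContinuousLinearEquiv.differentiableAt.comp
        y h2
    unfold christoffelLower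
    exact ((h2.add hf).sub ((differentiableAt_const _).clm_comp hf)).const_smul (1 / 2 : ℝ)
  exact ((ContinuousLinearMap.compL ℝ F (F →L[ℝ] ℝ) F).differentiableAt.comp y h1).clm_comp h3

/-- A product rule that keeps the derivative as an opaque `L` known only through its values, so
later computations can rewrite pointwise. -/
theorem hasFDerivAt_apply₂ {E F' H : Type*} [NormedAddCommGroup E] [NormedSpace ℝ E]
    [NormedAddCommGroup F'] [NormedSpace ℝ F'] [NormedAddCommGroup H] [NormedSpace ℝ H]
    {B : E → F →L[ℝ] F' →L[ℝ] H} {a : E → F} {b : E → F'} {x : E}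
    (hB : DifferentiableAt ℝ B x) (ha : DifferentiableAt ℝ a x) (hb : DifferentiableAt ℝ b x) :
    ∃ L : E →L[ℝ] H, HasFDerivAt (fun x => B x (a x) (b x)) L x ∧
      ∀ v, L v = fderiv ℝ B x v (a x) (b x) + B x (fderiv ℝ a x v) (b x)
        + B x (a x) (fderiv ℝ b x v) := by
  refine ⟨_, (hB.hasFDerivAt.clm_apply ha.hasFDerivAt).clm_apply hb.hasFDerivAt, fun v => ?_⟩
  simp
  abel

theorem curvature_skew (Γ : F → F →L[ℝ] F →L[ℝ] F) (x v w z : F) :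
    curvature Γ x v w z = -curvature Γ x w v z := by
  rw [curvature_apply, curvature_apply]
  abel

/-- Torsion-freeness holds on a neighbourhood, so it passes to the derivative of `Γ`; the derivative
and quadratic terms then cancel in the cyclic sum. -/
theorem curvature_bianchi [CompleteSpace F] (hG : ContDiffAt ℝ ∞ G y)
    (hs : ∀ᶠ y' in 𝓝 y, ∀ v w, G y' v w = G y' w v) (hi : (G y).IsInvertible) (u v w : F) :
    curvature (christoffel G) y u v w + curvature (christoffel G) y v w u
      + curvature (christoffel G) y w u v = 0 := by
  have hd := eventually_differentiableAt_of_contDiffAt hG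
  have hsy : ∀ᶠ y' in 𝓝 y, ∀ v w, christoffel G y' v w = christoffel G y' w v := by
    filter_upwards [hd, hs.eventually_nhds] with y' h1 h2 v w using christoffel_symm h1 h2 v w
  have hΓ := differentiableAt_christoffel hG hi
  have hD : ∀ u v w, fderiv ℝ (christoffel G) y u v w = fderiv ℝ (christoffel G) y u w v := by
    intro u v w
    have h1 := (hΓ.hasFDerivAt.clm_apply (hasFDerivAt_const v y)).clm_apply (hasFDerivAt_const w y)
    have h2 := (hΓ.hasFDerivAt.clm_apply (hasFDerivAt_const w y)).clm_apply (hasFDerivAt_const v y)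
    have h3 := h1.congr_of_eventuallyEq (f₁ := fun x => christoffel G x w v) (by
      filter_upwards [hsy] with x hx using hx _ _)
    simpa using (congrArg (fun L : F →L[ℝ] F => L u) (h2.unique h3)).symm
  have h0 := hsy.self_of_nhds
  simp only [curvature_apply]
  rw [hD u v w, hD v w u, hD w u v, h0 v w, h0 w u, h0 u v]
  abel

set_option maxSynthPendingDepth 4 in
theorem form_curvature_skew [CompleteSpace F] (hG : ContDiffAt ℝ ∞ G y)
    (hs : ∀ᶠ y' in 𝓝 y, ∀ v w, G y' v w = G y' w v) (hi : (G y).IsInvertible) (u v w z : F) :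
    G y (curvature (christoffel G) y u v w) z = -G y (curvature (christoffel G) y u v z) w := by
  have hd := eventually_differentiableAt_of_contDiffAt hG
  have hi' := eventually_isInvertible hG.continuousAt hi
  have hΓ := differentiableAt_christoffel hG hi
  have hG1 : DifferentiableAt ℝ G y := hG.differentiableAt (by simp)
  have h2 : DifferentiableAt ℝ (fderiv ℝ G) y := differentiableAt_fderiv_of_contDiffAt hG
  have hs0 := hs.self_of_nhds
  -- Metric compatibility differentiated once more. Antisymmetrising in `u`, `v` kills the left side
  -- by symmetry of second derivatives and leaves the curvature terms on the right.
  have key : ∀ u v, fderiv ℝ (fderiv ℝ G) y u v w z =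
      G y (christoffel G y u (christoffel G y v w)) z + G y (christoffel G y v w) (christoffel G y u z)
      + G y (fderiv ℝ (christoffel G) y u v w) z
      + (G y (christoffel G y u (christoffel G y v z)) w
        + G y (christoffel G y v z) (christoffel G y u w)
      + G y (fderiv ℝ (christoffel G) y u v z) w) := by
    intro u v
    have hw : ∀ w : F, HasFDerivAt (fun y => christoffel G y v w)
        (((fderiv ℝ (christoffel G) y).flip v).flip w) y := fun w => by
      simpa using! (hΓ.hasFDerivAt.clm_apply (hasFDerivAt_const v y)).clm_apply
        (hasFDerivAt_const w y)
    obtain ⟨L₁, hL₁, hL₁'⟩ := hasFDerivAt_apply₂ hG1 (hw w).differentiableAt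
      (differentiableAt_const z)
    obtain ⟨L₂, hL₂, hL₂'⟩ := hasFDerivAt_apply₂ hG1 (hw z).differentiableAt
      (differentiableAt_const w)
    have h3 := ((h2.hasFDerivAt.clm_apply (hasFDerivAt_const v y)).clm_apply
      (hasFDerivAt_const w y)).clm_apply (hasFDerivAt_const z y)
    have h4 := (hL₁.add hL₂).congr_of_eventuallyEq (f₁ := fun y => fderiv ℝ G y v w z) (by
      filter_upwards [hd, hs, hs.eventually_nhds, hi'] with y' h1 h2 h2' h3
      rw [fderiv_form_eq h1 h2' h3, h2 w]
      rfl)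
    have := congrArg (fun L : F →L[ℝ] ℝ => L u) (h3.unique h4)
    simp [hL₁', hL₂', (hw _).fderiv, fderiv_form_eq hG1 hs hi] at this
    exact this
  have hsym : fderiv ℝ (fderiv ℝ G) y u v = fderiv ℝ (fderiv ℝ G) y v u :=
    (hG.isSymmSndFDerivAt minSmoothness_two_le) u v
  have h5 := key u v
  rw [hsym, key v u, hs0 (christoffel G y u w), hs0 (christoffel G y u z)] at h5
  simp only [curvature_apply, map_add, map_sub, _root_.add_apply,
    _root_.sub_apply]
  linarith

end LeviCivita

/-! ### The Gauss equation along a null transversal field. -/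

section Gauss

variable {E F : Type*} [NormedAddCommGroup E] [NormedSpace ℝ E] [NormedAddCommGroup F]
  [NormedSpace ℝ F] [CompleteSpace F]

set_option maxSynthPendingDepth 4 in
/-- The Gauss equation in coordinates: if the covariant derivative of the coordinate fields along
an immersion `φ` is `Dφ Γ'(v, w)` up to multiples of a null field `n`, then the components along
`n` of the curvature of the ambient space and of the induced connection agree. -/
theorem gauss_equation {G : F → F →L[ℝ] F →L[ℝ] ℝ} {φ : E → F} {x : E}
    {n : E → F} {Γ' : E → E →L[ℝ] E →L[ℝ] E}
    (hφ : ContDiffAt ℝ ∞ φ x) (hG : ContDiffAt ℝ ∞ G (φ x))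
    (hs : ∀ᶠ y' in 𝓝 (φ x), ∀ v w, G y' v w = G y' w v) (hi : (G (φ x)).IsInvertible)
    (hn : DifferentiableAt ℝ n x) (hnull : ∀ᶠ x' in 𝓝 x, G (φ x') (n x') (n x') = 0)
    (hΓ' : DifferentiableAt ℝ Γ' x)
    (h : ∀ᶠ x' in 𝓝 x, ∀ v w, ∃ β : ℝ, fderiv ℝ (fderiv ℝ φ) x' v w
      + christoffel G (φ x') (fderiv ℝ φ x' v) (fderiv ℝ φ x' w)
      = fderiv ℝ φ x' (Γ' x' v w) + β • n x') (v w z : E) :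
    G (φ x) (n x) (curvature (christoffel G) (φ x)
        (fderiv ℝ φ x v) (fderiv ℝ φ x w) (fderiv ℝ φ x z))
      = G (φ x) (n x) (fderiv ℝ φ x (curvature Γ' x v w z)) := by
  have hΓ := differentiableAt_christoffel hG hi
  have hG1 : DifferentiableAt ℝ G (φ x) := hG.differentiableAt (by simp)
  have hφ0 : DifferentiableAt ℝ φ x := hφ.differentiableAt (by simp)
  have hφ1 : ContDiffAt ℝ ∞ (fderiv ℝ φ) x := hφ.fderiv_right (m := ∞) (by simp)
  have hφ2 : ContDiffAt ℝ ∞ (fderiv ℝ (fderiv ℝ φ)) x := hφ1.fderiv_right (m := ∞) (by simp)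
  have hφ1d : DifferentiableAt ℝ (fderiv ℝ φ) x := hφ1.differentiableAt (by simp)
  have hφ2d : DifferentiableAt ℝ (fderiv ℝ (fderiv ℝ φ)) x := hφ2.differentiableAt (by simp)
  have hsym : ∀ v w, fderiv ℝ (fderiv ℝ φ) x v w = fderiv ℝ (fderiv ℝ φ) x w v :=
    hφ.isSymmSndFDerivAt minSmoothness_two_le
  have hsym3 : ∀ v w, fderiv ℝ (fderiv ℝ (fderiv ℝ φ)) x v w =
      fderiv ℝ (fderiv ℝ (fderiv ℝ φ)) x w v := hφ1.isSymmSndFDerivAt minSmoothness_two_le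
  have hGφ : HasFDerivAt (fun x => G (φ x)) ((fderiv ℝ G (φ x)) ∘L fderiv ℝ φ x) x :=
    HasFDerivAt.comp (g := G) x hG1.hasFDerivAt hφ0.hasFDerivAt
  have hΓφ : HasFDerivAt (fun x => christoffel G (φ x))
      ((fderiv ℝ (christoffel G) (φ x)) ∘L fderiv ℝ φ x) x :=
    HasFDerivAt.comp (g := christoffel G) x hΓ.hasFDerivAt hφ0.hasFDerivAt
  have hs0 := hs.self_of_nhds
  have hΓs := christoffel_symm hG1 hs
  -- the covariant derivative of `n` is orthogonal to `n`
  have hnn : ∀ v, G (φ x) (fderiv ℝ n x v + christoffel G (φ x) (fderiv ℝ φ x v) (n x)) (n x)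
      = 0 := by
    intro v
    obtain ⟨L, hL, hL'⟩ := hasFDerivAt_apply₂ hGφ.differentiableAt hn hn
    have h1 := hL.congr_of_eventuallyEq (f₁ := fun _ => 0) (by
      filter_upwards [hnull] with x' hx' using hx'.symm)
    have h2 := congrArg (fun L : E →L[ℝ] ℝ => L v) (h1.unique (hasFDerivAt_const _ _))
    simp only [hL', hGφ.fderiv, ContinuousLinearMap.comp_apply, fderiv_form_eq hG1 hs hi,
      _root_.zero_apply] at h2
    rw [hs0 (n x), hs0 (n x)] at h2
    simp only [map_add, _root_.add_apply]
    linarith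
  -- The second fundamental form on coordinate fields, taking values in the line of `n`.
  let σ : E → E → E → F := fun w z x' => fderiv ℝ (fderiv ℝ φ) x' w z
      + christoffel G (φ x') (fderiv ℝ φ x' w) (fderiv ℝ φ x' z) - fderiv ℝ φ x' (Γ' x' w z)
  have hσ : ∀ᶠ x' in 𝓝 x, ∀ v w, ∃ β : ℝ, σ v w x' = β • n x' := by
    filter_upwards [h] with x' hx' v w
    obtain ⟨β, hβ⟩ := hx' v w
    exact ⟨β, by simp [σ, hβ]⟩
  have hσ0 : ∀ v w, G (φ x) (n x) (σ v w x) = 0 := by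
    intro v w
    obtain ⟨β, hβ⟩ := hσ.self_of_nhds v w
    rw [hβ, map_smul, hnull.self_of_nhds, smul_zero]
  have hσd : ∀ w z, ∃ L : E →L[ℝ] F, HasFDerivAt (σ w z) L x ∧ ∀ v, L v =
      fderiv ℝ (fderiv ℝ (fderiv ℝ φ)) x v w z
      + (fderiv ℝ (christoffel G) (φ x) (fderiv ℝ φ x v) (fderiv ℝ φ x w) (fderiv ℝ φ x z)
        + christoffel G (φ x) (fderiv ℝ (fderiv ℝ φ) x v w) (fderiv ℝ φ x z)
        + christoffel G (φ x) (fderiv ℝ φ x w) (fderiv ℝ (fderiv ℝ φ) x v z))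
      - (fderiv ℝ (fderiv ℝ φ) x v (Γ' x w z) + fderiv ℝ φ x (fderiv ℝ Γ' x v w z)) := by
    intro w z
    have hc : ∀ w, HasFDerivAt (fun x => fderiv ℝ φ x w) ((fderiv ℝ (fderiv ℝ φ) x).flip w) x :=
      fun w => by simpa using! hφ1d.hasFDerivAt.clm_apply (hasFDerivAt_const w x)
    obtain ⟨L, hL, hL'⟩ := hasFDerivAt_apply₂ hΓφ.differentiableAt (hc w).differentiableAt
      (hc z).differentiableAt
    have h1 := (hφ2d.hasFDerivAt.clm_apply (hasFDerivAt_const w x)).clm_apply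
      (hasFDerivAt_const z x)
    have h2 := (hΓ'.hasFDerivAt.clm_apply (hasFDerivAt_const w x)).clm_apply
      (hasFDerivAt_const z x)
    have h3 := hφ1d.hasFDerivAt.clm_apply h2
    refine ⟨_, (h1.add hL).sub h3, fun v => ?_⟩
    simp [hL', hΓφ.fderiv, (hc _).fderiv]
    abel
  choose L hL hL' using hσd
  -- Differentiate `G(n, σ) = 0`: the term `G(∇n, σ)` vanishes because `σ` is a multiple of `n` and
  -- `∇n ⊥ n`. So `∇σ` is orthogonal to `n`, whatever the coefficient of `n` in `σ`, whose
  -- smoothness is never needed.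
  have key : ∀ v w z, G (φ x) (n x)
      (L w z v + christoffel G (φ x) (fderiv ℝ φ x v) (σ w z x)) = 0 := by
    intro v w z
    obtain ⟨K, hK, hK'⟩ := hasFDerivAt_apply₂ hGφ.differentiableAt hn (hL w z).differentiableAt
    have h1 := hK.congr_of_eventuallyEq (f₁ := fun _ => 0) (by
      filter_upwards [hσ, hnull] with x' hx' hx''
      obtain ⟨β, hβ⟩ := hx' w z
      rw [hβ, map_smul, hx'', smul_zero])
    have h2 := congrArg (fun L : E →L[ℝ] ℝ => L v) (h1.unique (hasFDerivAt_const _ _))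
    simp only [hK', hGφ.fderiv, ContinuousLinearMap.comp_apply, fderiv_form_eq hG1 hs hi,
      _root_.zero_apply, (hL w z).fderiv] at h2
    have h3 : G (φ x) (fderiv ℝ n x v + christoffel G (φ x) (fderiv ℝ φ x v) (n x)) (σ w z x)
        = 0 := by
      obtain ⟨β, hβ⟩ := hσ.self_of_nhds w z
      rw [hβ, map_smul, hnn, smul_zero]
    simp only [map_add, _root_.add_apply] at h3 ⊢
    linarith
  -- Antisymmetrise `∇_v σ(w, z)` in `v`, `w`. The third derivatives of `φ` cancel, and `h3`, `h4`
  -- replace the derivatives of `Dφ` on `Γ'` by their tangential parts.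
  have h1 := key v w z
  have h2 := key w v z
  have h3 := hσ0 v (Γ' x w z)
  have h4 := hσ0 w (Γ' x v z)
  simp only [hL', σ, map_add, map_sub] at h1 h2 h3 h4
  rw [hsym3 w v, hsym w v] at h2
  simp only [curvature_apply, map_add, map_sub]
  linarith

end Gauss

/-! ### Algebraic curvature tensors and constant sectional curvature. -/

section CurvatureTensors

namespace IsAlgebraicCurvature

variable {V : Type*} {T : V → V → V → V → ℝ}

/-- Combine the four Bianchi sums for the cyclic shifts of `(x, y, z, w)`; after using both skew
symmetries, only the difference of the two paired terms survives. -/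
theorem of_skew (h₁ : ∀ x y z w, T x y z w = -T y x z w) (h₂ : ∀ x y z w, T x y z w = -T x y w z)
    (h₃ : ∀ x y z w, T x y z w + T y z x w + T z x y w = 0) : IsAlgebraicCurvature T where
  skew := h₁
  pair_symm x y z w := by
    linarith [h₃ x y z w, h₃ y z w x, h₃ z w x y, h₃ w x y z, h₂ x y z w, h₁ x y z w, h₁ x y w z,
      h₂ y z w x, h₁ y z w x, h₂ y z x w, h₁ y z x w, h₂ z w x y, h₁ z w x y, h₂ w x y z,
      h₁ w x y z, h₂ z x y w, h₁ z x y w, h₂ w y z x, h₁ w y z x, h₂ x z w y, h₁ x z w y,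
      h₂ y w x z, h₁ y w x z, h₁ z x w y, h₁ y w z x, h₁ w y x z]
  bianchi := h₃

theorem skew_right (hT : IsAlgebraicCurvature T) (x y z w : V) : T x y z w = -T x y w z := by
  rw [hT.pair_symm, hT.skew, hT.pair_symm]

/-- An algebraic curvature tensor is determined by its sectional curvatures. -/
theorem eq_zero [AddCommGroup V] (hT : IsAlgebraicCurvature T)
    (hadd : ∀ x x' y z w, T (x + x') y z w = T x y z w + T x' y z w)
    (h : ∀ v w, T v w w v = 0) (x y z w : V) : T x y z w = 0 := by
  have add₂ : ∀ x y y' z w, T x (y + y') z w = T x y z w + T x y' z w := fun x y y' z w => by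
    rw [hT.skew, hadd, hT.skew x y, hT.skew x y']; ring
  have add₃ : ∀ x y z z' w, T x y (z + z') w = T x y z w + T x y z' w := fun x y z z' w => by
    rw [hT.pair_symm, hadd, hT.pair_symm x y z, hT.pair_symm x y z']
  have add₄ : ∀ x y z w w', T x y z (w + w') = T x y z w + T x y z w' := fun x y z w w' => by
    rw [hT.pair_symm, add₂, hT.pair_symm x y z w, hT.pair_symm x y z w']
  -- Polarisation in the middle slots, where pair symmetry makes the form symmetric.
  have h₁ : ∀ v w z, T v w z v = 0 := by
    intro v w z
    have h0 := h v (w + z)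
    rw [add₂, add₃, add₃, h, h] at h0
    have h1 : T v z w v = T v w z v := by
      rw [hT.pair_symm v z w v, hT.skew w v, hT.skew_right v w v z]; ring
    linarith
  -- Polarisation in the outer slots makes `T` skew in the middle pair. It is then invariant under
  -- cyclic shifts of the first three slots, so the Bianchi identity reads `3 T = 0`.
  have h₂ : ∀ x y z w, T x y z w = -T x z y w := by
    intro x y z w
    have h0 := h₁ (x + w) y z
    rw [hadd, add₄, add₄, h₁, h₁] at h0
    have h1 : T w y z x = T x z y w := by
      rw [hT.pair_symm w y z x, hT.skew z x, hT.skew_right x z w y]; ring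
    linarith
  linarith [hT.bianchi x y z w, hT.skew y z x w, hT.skew z x y w, h₂ x y z w, h₂ y x z w,
    hT.skew y x z w]

end IsAlgebraicCurvature

variable {F : Type*} [NormedAddCommGroup F] [NormedSpace ℝ F]

/-- Curvature tensors of constant sectional curvature `c` have the standard form. -/
theorem curvature_eq_of_constant_sectional {b : F →L[ℝ] F →L[ℝ] ℝ}
    {R : F →L[ℝ] F →L[ℝ] F →L[ℝ] F} {c : ℝ} (hb : ∀ v w, b v w = b w v)
    (hR : IsAlgebraicCurvature fun x y z w => b (R x y z) w)
    (hne : ∃ v w, b v v * b w w - b v w ^ 2 ≠ 0)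
    (hc : ∀ v w, b v v * b w w - b v w ^ 2 ≠ 0 →
      b (R v w w) v / (b v v * b w w - b v w ^ 2) = c) (x y z w : F) :
    b (R x y z) w = c * (b y z * b x w - b x z * b y w) := by
  have key : ∀ v w, b (R v w w) v = c * (b v v * b w w - b v w ^ 2) := by
    obtain ⟨v₀, w₀, h₀⟩ := hne
    intro v w
    -- Degenerate planes are reached along the segment from `(v, w)` at `t = 0` to a nondegenerate
    -- pair at `t = 1`. The discriminant times the defect of the formula vanishes identically, so
    -- one analytic factor is zero; the discriminant is not, by its value at `t = 1`.
    let p : ℝ → F := fun t => v + t • (v₀ - v)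
    let q : ℝ → F := fun t => w + t • (w₀ - w)
    have hD : AnalyticOnNhd ℝ (fun t => b (p t) (p t) * b (q t) (q t) - b (p t) (q t) ^ 2)
        Set.univ := fun t _ => by
      simp only [p, q, map_add, map_smul, _root_.add_apply, _root_.smul_apply, smul_eq_mul]
      fun_prop
    have hT : AnalyticOnNhd ℝ (fun t => b (R (p t) (q t) (q t)) (p t)) Set.univ := fun t _ => by
      simp only [p, q, map_add, map_smul, _root_.add_apply, _root_.smul_apply, smul_eq_mul]
      fun_prop
    have := AnalyticOnNhd.eq_zero_or_eq_zero_of_mul_eq_zero hD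
      (hT.sub (analyticOnNhd_const (v := c) |>.mul hD)) (fun t _ => by
        by_cases h : b (p t) (p t) * b (q t) (q t) - b (p t) (q t) ^ 2 = 0
        · simp [h]
        · have := hc _ _ h
          rw [div_eq_iff h] at this
          simp [this]) isPreconnected_univ
    rcases this with h | h
    · exact absurd (by simpa [p, q] using h 1 trivial) h₀
    · have := h 0 trivial
      simp only [p, q, zero_smul, add_zero, Pi.sub_apply] at this
      linarith
  have hD : IsAlgebraicCurvature
      fun x y z w => b (R x y z) w - c * (b y z * b x w - b x z * b y w) := by
    refine ⟨fun x y z w => ?_, fun x y z w => ?_, fun x y z w => ?_⟩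
    · have := hR.skew x y z w
      linarith
    · have := hR.pair_symm x y z w
      simp only [this, hb z x, hb w y, hb w x, hb z y]
      ring
    · have := hR.bianchi x y z w
      simp only [hb z x, hb z y, hb y x]
      linarith
  have := hD.eq_zero (fun x x' y z w => by simp; ring) (fun v w => by
    simp only [key, hb w v]
    ring) x y z w
  linarith

end CurvatureTensors

/-! ### Linear algebra of a lightlike hyperplane and its null transversal line. -/

section LightlikeHyperplanes

variable {V W : Type*} [AddCommGroup V] [Module ℝ V] [TopologicalSpace V]
  [AddCommGroup W] [Module ℝ W] [TopologicalSpace W]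

theorem mem_radical_iff {b : V →L[ℝ] V →L[ℝ] ℝ} {v : V} : v ∈ radical b ↔ ∀ w, b v w = 0 := by
  rw [radical, LinearMap.mem_ker]
  exact ContinuousLinearMap.ext_iff

/-- A vector `ξ` of the radical of the pullback of `b` along `A : W → V` and a null vector `n` of
`V` orthogonal to the screen `S` with `b(n, A ξ) = 1`. -/
structure IsNullTransversalPair (b : V →L[ℝ] V →L[ℝ] ℝ) (A : W →L[ℝ] V) (S : Submodule ℝ W)
    (ξ : W) (n : V) : Prop where
  mem_radical : ∀ w, b (A ξ) (A w) = 0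
  null : b n n = 0
  orthogonal : ∀ s ∈ S, b n (A s) = 0
  normalized : b n (A ξ) = 1

variable {b : V →L[ℝ] V →L[ℝ] ℝ} {A : W →L[ℝ] V} {S : Submodule ℝ W} {ξ ξ' : W} {n n' : V}

variable [FiniteDimensional ℝ V] [FiniteDimensional ℝ W]

/-- Nondegeneracy of `b` represents a functional that kills the screen and is `1` on `ξ` by a vector
`m`. Subtracting `½ b(m, m) A ξ` makes it null without disturbing the other conditions, since `A ξ`
is orthogonal to the hyperplane. -/
theorem exists_isNullTransversalPair (hb : ∀ v w, b v w = b w v)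
    (hnd : ∀ v, (∀ w, b v w = 0) → v = 0) (hA : Function.Injective A)
    (hrad : finrank ℝ (radical (pullbackForm b A)) = 1)
    (hS : IsCompl (radical (pullbackForm b A)) S) : ∃ ξ n, IsNullTransversalPair b A S ξ n := by
  obtain ⟨⟨ξ, hξ⟩, hξ0, -⟩ := finrank_eq_one_iff'.1 hrad
  have hξr : ∀ w, b (A ξ) (A w) = 0 := mem_radical_iff.1 hξ
  have hξS : ξ ∉ S := fun h => hξ0 (Subtype.ext (by
    simpa using hS.disjoint.le_bot ⟨hξ, h⟩))
  obtain ⟨l, hl, hlS⟩ := Submodule.exists_le_ker_of_notMem hξS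
  obtain ⟨B, hB⟩ := (A : W →ₗ[ℝ] V).exists_leftInverse_of_injective (LinearMap.ker_eq_bot.2 hA)
  have hinj : Function.Injective (ContinuousLinearMap.coeLM ℝ ∘ₗ (b : V →ₗ[ℝ] V →L[ℝ] ℝ)) := by
    rw [← LinearMap.ker_eq_bot, LinearMap.ker_eq_bot']
    exact fun v hv => hnd v fun w => LinearMap.congr_fun hv w
  have hsurj := (LinearMap.injective_iff_surjective_of_finrank_eq_finrank
    (Subspace.dual_finrank_eq (K := ℝ) (V := V)).symm).1 hinj
  obtain ⟨m, hm⟩ := hsurj ((l ξ)⁻¹ • (l ∘ₗ B))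
  have hm' : ∀ w, b m (A w) = (l ξ)⁻¹ * l w := fun w => by
    have h1 : b m (A w) = (l ξ)⁻¹ * l (B (A w)) := LinearMap.congr_fun hm (A w)
    have h2 : B (A w) = w := LinearMap.congr_fun hB w
    rw [h1, h2]
  have hmξ : b m (A ξ) = 1 := by rw [hm', inv_mul_cancel₀ hl]
  refine ⟨ξ, m - (1 / 2 * b m m) • A ξ, hξr, ?_, fun s hs => ?_, ?_⟩
  · simp [hξr, hmξ, hb (A ξ) m]
    ring
  · simp [hm', hξr, LinearMap.mem_ker.1 (hlS hs)]
  · simp [hξr, hmξ]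

namespace IsNullTransversalPair

/-- The space is the direct sum of the lightlike hyperplane and the null transversal line. -/
theorem coprod_bijective (h : IsNullTransversalPair b A S ξ n) (hb : ∀ v w, b v w = b w v)
    (hA : Function.Injective A) (hdim : finrank ℝ V = finrank ℝ W + 1) :
    Function.Bijective ((A : W →ₗ[ℝ] V).coprod (LinearMap.toSpanSingleton ℝ V n)) := by
  have hinj : Function.Injective
      ((A : W →ₗ[ℝ] V).coprod (LinearMap.toSpanSingleton ℝ V n)) := by
    rw [← LinearMap.ker_eq_bot, LinearMap.ker_eq_bot']
    rintro ⟨w, t⟩ hw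
    have hw : A w + t • n = 0 := by simpa using hw
    have h1 := congrArg (b (A ξ)) hw
    have ht : t = 0 := by simpa [h.mem_radical, hb (A ξ) n, h.normalized] using h1
    rw [ht, zero_smul, add_zero] at hw
    rw [ht, hA (hw.trans (map_zero A).symm)]
    rfl
  exact ⟨hinj, (LinearMap.injective_iff_surjective_of_finrank_eq_finrank (by simp [hdim])).1 hinj⟩

theorem exists_eq_add (h : IsNullTransversalPair b A S ξ n) (hb : ∀ v w, b v w = b w v)
    (hA : Function.Injective A) (hdim : finrank ℝ V = finrank ℝ W + 1) (v : V) :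
    ∃ (w : W) (t : ℝ), v = A w + t • n := by
  obtain ⟨⟨w, t⟩, hw⟩ := (h.coprod_bijective hb hA hdim).2 v
  exact ⟨w, t, by simpa using hw.symm⟩

/-- The null transversal line of a screen is unique. -/
theorem mem_span (h : IsNullTransversalPair b A S ξ n) (h' : IsNullTransversalPair b A S ξ' n')
    (hb : ∀ v w, b v w = b w v) (hA : Function.Injective A) (hdim : finrank ℝ V = finrank ℝ W + 1)
    (hrad : finrank ℝ (radical (pullbackForm b A)) = 1)
    (hS : IsCompl (radical (pullbackForm b A)) S) : ∃ a : ℝ, n' = a • n := by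
  have hξ : ξ ∈ radical (pullbackForm b A) := mem_radical_iff.2 h.mem_radical
  have hspan : ∀ w ∈ radical (pullbackForm b A), ∃ a : ℝ, a • ξ = w := by
    intro w hw
    have h0 : (⟨ξ, hξ⟩ : radical (pullbackForm b A)) ≠ 0 := fun h0 => by
      have : ξ = 0 := congrArg Subtype.val h0
      simpa [this] using h.normalized
    obtain ⟨a, ha⟩ := (finrank_eq_one_iff_of_nonzero' _ h0).1 hrad ⟨w, hw⟩
    exact ⟨a, congrArg Subtype.val ha⟩
  obtain ⟨a, rfl⟩ := hspan ξ' (mem_radical_iff.2 h'.mem_radical)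
  have ha : a * b n' (A ξ) = 1 := by simpa using h'.normalized
  have ha0 : a ≠ 0 := left_ne_zero_of_mul_eq_one ha
  have hn'ξ : b n' (A ξ) = a⁻¹ := eq_inv_of_mul_eq_one_right ha
  -- Being orthogonal to the whole hyperplane, this difference is a multiple `s • A ξ`; nullity of
  -- `n'` then forces `2 a⁻¹ s = 0`.
  have horth : ∀ w, b (n' - a⁻¹ • n) (A w) = 0 := by
    intro w
    obtain ⟨r, hr, s, hs, rfl⟩ := Submodule.mem_sup.1
      (hS.sup_eq_top ▸ Submodule.mem_top : w ∈ radical (pullbackForm b A) ⊔ S)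
    obtain ⟨t, rfl⟩ := hspan r hr
    simp [h.orthogonal s hs, h'.orthogonal s hs, h.normalized, hn'ξ, mul_comm]
  obtain ⟨w, t, hw⟩ := h.exists_eq_add hb hA hdim (n' - a⁻¹ • n)
  have ht : t = 0 := by
    have h1 := horth ξ
    rw [hw] at h1
    simpa [hb (A w), h.mem_radical, h.normalized] using h1
  rw [ht, zero_smul, add_zero] at hw
  obtain ⟨s, rfl⟩ := hspan w (mem_radical_iff.2 fun w' => by
    simpa [hw] using horth w')
  have hn' : n' = a⁻¹ • n + s • A ξ := by
    rw [sub_eq_iff_eq_add'] at hw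
    rw [hw, map_smul]
  have h2 := h'.null
  rw [hn'] at h2
  simp [h.null, h.normalized, h.mem_radical, hb (A ξ) n] at h2
  have hs : s = 0 := by
    have h3 : 2 * (a⁻¹ * s) = 0 := by linarith
    simpa [ha0] using h3
  exact ⟨a⁻¹, by rw [hn', hs]; simp⟩

end IsNullTransversalPair

end LightlikeHyperplanes

/-! ### The pointwise algebra: traces of the pseudo-Jacobi and Ricci operators. -/

section Einstein

variable {E : Type*} [NormedAddCommGroup E] [NormedSpace ℝ E]

/-- A quadratic form that is constant on a nonempty pseudo-sphere of `b` is a multiple of `b`. -/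
theorem eq_mul_of_constant_on_pseudosphere {q b : E →L[ℝ] E →L[ℝ] ℝ} (hq : ∀ x y, q x y = q y x)
    (hb : ∀ x y, b x y = b y x) {ε l : ℝ} (hε : ε ^ 2 = 1) {x₀ : E} (h₀ : b x₀ x₀ = ε)
    (h : ∀ x, b x x = ε → q x x = l) (x y : E) : q x y = ε * l * b x y := by
  -- Homogeneity extends the hypothesis from the pseudo-sphere to the open cone around it.
  have key : ∀ x, 0 < ε * b x x → q x x = ε * l * b x x := by
    intro x hx
    set r := Real.sqrt (ε * b x x) with hr
    have hr2 : r ^ 2 = ε * b x x := Real.sq_sqrt hx.le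
    have hr0 : r ≠ 0 := (Real.sqrt_pos.2 hx).ne'
    have hbx : b x x = ε * r ^ 2 := by rw [hr2, ← mul_assoc, ← sq, hε, one_mul]
    have h1 := h (r⁻¹ • x) (by
      simp [hbx]; field_simp)
    have h2 : q x x = l * r ^ 2 := by
      simp at h1
      rw [← h1]; field_simp
    rw [h2, hr2]; ring
  -- For small `t ≠ 0` both `x₀ ± t y` lie in the open cone; the second difference of the quadratic
  -- identity isolates `t² q(y, y)`.
  have diag : ∀ y, q y y = ε * l * b y y := by
    intro y
    have hcont : Continuous fun t : ℝ => ε * b (x₀ + t • y) (x₀ + t • y) := by fun_prop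
    have hev : ∀ᶠ t in 𝓝 (0 : ℝ), 0 < ε * b (x₀ + t • y) (x₀ + t • y) := by
      refine hcont.continuousAt.eventually (lt_mem_nhds ?_)
      simp [h₀, ← sq, hε]
    have hev' : ∀ᶠ t in 𝓝 (0 : ℝ), 0 < ε * b (x₀ + (-t) • y) (x₀ + (-t) • y) := by
      have : Filter.Tendsto (fun t : ℝ => -t) (𝓝 0) (𝓝 0) := by
        simpa using (continuous_neg.tendsto (0 : ℝ))
      exact this.eventually hev
    obtain ⟨t, ⟨ht, ht'⟩, ht0⟩ := (((hev.and hev').filter_mono nhdsWithin_le_nhds).and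
      (self_mem_nhdsWithin (a := (0 : ℝ)) (s := {0}ᶜ))).exists
    have h1 := key _ ht
    have h2 := key _ ht'
    have h3 := key x₀ (by simp [h₀, ← sq, hε])
    simp at h1 h2
    rw [hq y x₀, hb y x₀] at h1 h2
    have h4 : t ^ 2 * (q y y - ε * l * b y y) = 0 := by linarith
    have h5 : t ^ 2 ≠ 0 := pow_ne_zero 2 ht0
    linarith [(mul_eq_zero.1 h4).resolve_left h5]
  have h1 := diag (x + y)
  simp [hq y x, hb y x] at h1
  linarith [diag x, diag y]

variable {b : E →L[ℝ] E →L[ℝ] ℝ} {η : E →L[ℝ] ℝ} {ξ : E}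
  {R : E →L[ℝ] E →L[ℝ] E →L[ℝ] E}

/-- Thus `g̃⁻¹ ∘ g` is the projection onto `ker η` along `ξ`: `g̃` sends `ξ` to `η`, which removes
the extra term `η(v) η`. -/
theorem inverse_add_smulRight_apply (hξ : b ξ = 0) (hη : η ξ = 1)
    (hi : (b + η.smulRight η).IsInvertible) (v : E) :
    (b + η.smulRight η).inverse (b v) = v - η v • ξ := by
  rw [hi.inverse_apply_eq]
  ext w
  simp [hξ, hη]

variable [FiniteDimensional ℝ E]

theorem isInvertible_of_injective {F : Type*} [NormedAddCommGroup F] [NormedSpace ℝ F]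
    [FiniteDimensional ℝ F] {A : E →L[ℝ] F} (hA : Function.Injective A)
    (hd : finrank ℝ E = finrank ℝ F) : A.IsInvertible :=
  ⟨(LinearEquiv.ofInjectiveOfFinrankEq (A : E →ₗ[ℝ] F) hA hd).toContinuousLinearEquiv, by
    ext; rfl⟩

theorem finrank_continuousDual : finrank ℝ (E →L[ℝ] ℝ) = finrank ℝ E := by
  rw [← (LinearMap.toContinuousLinearMap (𝕜 := ℝ) (E := E) (F' := ℝ)).finrank_eq]
  exact Subspace.dual_finrank_eq

theorem isInvertible_of_nondegenerate (h : ∀ v, (∀ w, b v w = 0) → v = 0) : b.IsInvertible := by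
  refine isInvertible_of_injective ?_ finrank_continuousDual.symm
  rw [injective_iff_map_eq_zero]
  exact fun v hv => h v fun w => by rw [hv]; rfl

/-- Pairing a kernel vector with `ξ` gives `η v = 0`; then `v` lies in the radical, where `η` is
injective. -/
theorem isInvertible_add_smulRight (hξ : b ξ = 0) (hb : ∀ x y, b x y = b y x) (hη : η ξ = 1)
    (hrad : finrank ℝ (radical b) = 1) : (b + η.smulRight η).IsInvertible := by
  refine isInvertible_of_nondegenerate fun v hv => ?_
  have h1 : η v = 0 := by simpa [hb v, hξ, hη] using hv ξ
  have h2 : v ∈ radical b := mem_radical_iff.2 fun w => by simpa [h1] using hv w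
  have h0 : (⟨ξ, hξ⟩ : radical b) ≠ 0 := fun h0 => by
    have : ξ = 0 := congrArg Subtype.val h0
    simp [this] at hη
  obtain ⟨a, ha⟩ := (finrank_eq_one_iff_of_nonzero' _ h0).1 hrad ⟨v, h2⟩
  have ha : a • ξ = v := congrArg Subtype.val ha
  rw [← ha, map_smul, hη] at h1
  simp at h1
  rw [← ha, h1, zero_smul]

/-- The operator `z ↦ P R(x, z)y`, where `P` is the projection onto the screen along the radical. -/
def screenRicciOperator (b : E →L[ℝ] E →L[ℝ] ℝ) (η : E →L[ℝ] ℝ) (R : E →L[ℝ] E →L[ℝ] E →L[ℝ] E)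
    (x y : E) : E →L[ℝ] E :=
  (b + η.smulRight η).inverse ∘L b ∘L (R x).flip y

theorem trace_screenRicciOperator_symm (hb : ∀ x y, b x y = b y x)
    (hi : (b + η.smulRight η).IsInvertible)
    (hR : IsAlgebraicCurvature fun x y z w => b (R x y z) w) (x y : E) :
    LinearMap.trace ℝ E (screenRicciOperator b η R x y : E →ₗ[ℝ] E) =
      LinearMap.trace ℝ E (screenRicciOperator b η R y x : E →ₗ[ℝ] E) := by
  -- `B` is `g̃` as an isomorphism onto the dual. Conjugating by it turns the operator for `(x, y)`
  -- into the transpose of the one for `(y, x)`, because `R(x, v, y, w) = R(y, w, x, v)`.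
  let B : E ≃ₗ[ℝ] Dual ℝ E := LinearEquiv.ofInjectiveOfFinrankEq
    (ContinuousLinearMap.coeLM ℝ ∘ₗ ((b + η.smulRight η : E →L[ℝ] E →L[ℝ] ℝ) : E →ₗ[ℝ] E →L[ℝ] ℝ))
    (by
      obtain ⟨e, he⟩ := hi
      intro v w hvw
      apply e.injective
      have h1 : (b + η.smulRight η) v = (b + η.smulRight η) w :=
        ContinuousLinearMap.ext fun z => LinearMap.congr_fun hvw z
      rw [← he] at h1
      exact h1) Subspace.dual_finrank_eq.symm
  have hB : ∀ v w, B v w = (b + η.smulRight η) v w := fun _ _ => rfl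
  have hsym : ∀ v w, B v w = B w v := fun v w => by
    simp [hB, hb v w, mul_comm]
  have hop : ∀ x y z w, B (screenRicciOperator b η R x y z) w = b (R x z y) w := by
    intro x y z w
    rw [hB, screenRicciOperator]
    have := (hi.inverse_apply_eq (y := b (R x z y))).1 rfl
    simp only [ContinuousLinearMap.comp_apply, ContinuousLinearMap.flip_apply]
    rw [← this]
  rw [← LinearMap.trace_conj' (screenRicciOperator b η R x y : E →ₗ[ℝ] E) B,
    ← LinearMap.trace_transpose' (screenRicciOperator b η R y x : E →ₗ[ℝ] E)]
  congr 1
  ext l w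
  obtain ⟨v, rfl⟩ := B.surjective l
  simp only [LinearEquiv.conj_apply_apply, LinearEquiv.symm_apply_apply]
  rw [Dual.transpose_apply]
  simp only [LinearMap.comp_apply, ContinuousLinearMap.coe_coe]
  rw [hop, hsym v, hop]
  exact hR.pair_symm x v y w

/-- The two operators differ by the rank-one map `z ↦ η(R(x, z) y) ξ`, whose trace is its functional
evaluated at `ξ`. -/
theorem trace_ricci_eq (hξ : b ξ = 0) (hη : η ξ = 1) (hi : (b + η.smulRight η).IsInvertible)
    (x y : E) :
    LinearMap.trace ℝ E ((R x).flip y : E →ₗ[ℝ] E) =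
      LinearMap.trace ℝ E (screenRicciOperator b η R x y : E →ₗ[ℝ] E) + η (R x ξ y) := by
  have : ((R x).flip y : E →ₗ[ℝ] E) = (screenRicciOperator b η R x y : E →ₗ[ℝ] E) +
      ((η ∘L (R x).flip y : E →L[ℝ] ℝ) : E →ₗ[ℝ] ℝ).smulRight ξ := by
    ext z
    simp [screenRicciOperator, inverse_add_smulRight_apply hξ hη hi]
  rw [this, map_add, LinearMap.trace_smulRight]
  rfl

theorem trace_eq_of_charpoly_eq {A B : E →ₗ[ℝ] E} (h : A.charpoly = B.charpoly) :
    LinearMap.trace ℝ E A = LinearMap.trace ℝ E B := by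
  have key : ∀ A : E →ₗ[ℝ] E, LinearMap.trace ℝ E A = -A.charpoly.nextCoeff := fun A => by
    rw [LinearMap.trace_eq_matrix_trace ℝ (finBasis ℝ E), Matrix.trace_eq_neg_charpoly_nextCoeff,
      LinearMap.charpoly_toMatrix]
  rw [key, key, h]

/-- If the pseudo-Jacobi operators over a nonempty pseudo-sphere have the same characteristic
polynomial and `η (R x ξ y)` is a multiple of the metric, then so is the Ricci tensor. -/
theorem exists_ricci_eq (hb : ∀ x y, b x y = b y x) (hξ : b ξ = 0) (hη : η ξ = 1)
    (hrad : finrank ℝ (radical b) = 1) (hR : IsAlgebraicCurvature fun x y z w => b (R x y z) w)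
    (hskew : ∀ x y z, R x y z = -R y x z) {c : ℝ} (hc : ∀ x y, η (R x ξ y) = c * b x y)
    {ε : ℝ} (hε : ε ^ 2 = 1) {x₀ : E} (h₀ : b x₀ x₀ = ε)
    (hJ : ∀ x y, b x x = ε → b y y = ε →
      LinearMap.charpoly (((b + η.smulRight η).inverse ∘L b ∘L (R.flip x).flip x : E →L[ℝ] E) :
        E →ₗ[ℝ] E) = LinearMap.charpoly (((b + η.smulRight η).inverse ∘L b ∘L (R.flip y).flip y :
        E →L[ℝ] E) : E →ₗ[ℝ] E)) :
    ∃ l : ℝ, ∀ x y, LinearMap.trace ℝ E ((R x).flip y : E →ₗ[ℝ] E) = l * b x y := by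
  have hi := isInvertible_add_smulRight hξ hb hη hrad
  let q : E →L[ℝ] E →L[ℝ] ℝ := LinearMap.toContinuousLinearMap
    ((LinearMap.toContinuousLinearMap (𝕜 := ℝ) (E := E) (F' := ℝ)).toLinearMap ∘ₗ
      LinearMap.mk₂ ℝ (fun x y => LinearMap.trace ℝ E (screenRicciOperator b η R x y : E →ₗ[ℝ] E))
        (fun x x' y => by
          rw [← map_add]; congr 1; ext z; simp [screenRicciOperator])
        (fun a x y => by
          rw [← map_smul]; congr 1; ext z; simp [screenRicciOperator])
        (fun x y y' => by
          rw [← map_add]; congr 1; ext z; simp [screenRicciOperator])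
        (fun a x y => by
          rw [← map_smul]; congr 1; ext z; simp [screenRicciOperator]))
  have hq : ∀ x y, q x y = LinearMap.trace ℝ E (screenRicciOperator b η R x y : E →ₗ[ℝ] E) :=
    fun _ _ => rfl
  have hqJ : ∀ x, q x x = -LinearMap.trace ℝ E
      (((b + η.smulRight η).inverse ∘L b ∘L (R.flip x).flip x : E →L[ℝ] E) : E →ₗ[ℝ] E) := by
    intro x
    rw [hq, ← map_neg]
    congr 1
    ext z
    simp [screenRicciOperator, hskew x z]
  have h := eq_mul_of_constant_on_pseudosphere (q := q) (fun x y => by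
    rw [hq, hq, trace_screenRicciOperator_symm hb hi hR]) hb hε h₀ (l := q x₀ x₀) (fun x hx => by
      rw [hqJ, hqJ, trace_eq_of_charpoly_eq (hJ x x₀ hx h₀)])
  exact ⟨ε * q x₀ x₀ + c, fun x y => by
    rw [trace_ricci_eq hξ hη hi, ← hq, h, hc]; ring⟩

end Einstein

/-! ### Differentiable dependence of the transversal vector and the projection. -/

section SmoothTransversal

variable {E F : Type*} [NormedAddCommGroup E] [NormedSpace ℝ E] [NormedAddCommGroup F]
  [NormedSpace ℝ F] {P : Type*} [NormedAddCommGroup P] [NormedSpace ℝ P]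

theorem differentiableAt_inverse [CompleteSpace E] {A : P → E →L[ℝ] F} {x : P}
    (hA : DifferentiableAt ℝ A x) (hi : (A x).IsInvertible) :
    DifferentiableAt ℝ (fun x => (A x).inverse) x :=
  ((hi.contDiffAt_map_inverse (n := ∞)).differentiableAt (by simp)).comp x hA

set_option maxSynthPendingDepth 4 in
theorem differentiableAt_bilinearComp {B : P → F →L[ℝ] F →L[ℝ] F} {A : P → E →L[ℝ] F} {x : P}
    (hB : DifferentiableAt ℝ B x) (hA : DifferentiableAt ℝ A x) :
    DifferentiableAt ℝ (fun x => (B x).bilinearComp (A x) (A x)) x := by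
  have h1 : DifferentiableAt ℝ (fun x => (B x ∘L A x).flip) x :=
    (ContinuousLinearMap.flipₗᵢ ℝ E F F).toContinuousLinearEquiv.differentiableAt.comp x
      (hB.clm_comp hA)
  have h2 : DifferentiableAt ℝ (fun x => (((B x ∘L A x).flip ∘L A x).flip)) x :=
    (ContinuousLinearMap.flipₗᵢ ℝ E E F).toContinuousLinearEquiv.differentiableAt.comp x
      (h1.clm_comp hA)
  exact h2

variable [FiniteDimensional ℝ E] [FiniteDimensional ℝ F]

/-- A family of hyperplanes with a frame of the screen depending differentiably on a parameter
admits null transversal vectors depending differentiably on the parameter. -/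
theorem exists_differentiableAt_isNullTransversalPair {b : P → F →L[ℝ] F →L[ℝ] ℝ}
    {A : P → E →L[ℝ] F} {k : ℕ} {X : Fin k → P → E} {x₀ : P}
    (hb : DifferentiableAt ℝ b x₀) (hA : DifferentiableAt ℝ A x₀)
    (hX : ∀ i, DifferentiableAt ℝ (X i) x₀)
    (h : ∀ᶠ x in 𝓝 x₀, (∀ v w, b x v w = b x w v) ∧ (∀ v, (∀ w, b x v w = 0) → v = 0) ∧
      Function.Injective (A x) ∧ finrank ℝ (radical (pullbackForm (b x) (A x))) = 1 ∧
      LinearIndependent ℝ (fun i => X i x) ∧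
      IsCompl (radical (pullbackForm (b x) (A x))) (Submodule.span ℝ (Set.range fun i => X i x))) :
    ∃ (ξ : P → E) (n : P → F), DifferentiableAt ℝ n x₀ ∧ ∀ᶠ x in 𝓝 x₀,
      IsNullTransversalPair (b x) (A x) (Submodule.span ℝ (Set.range fun i => X i x))
        (ξ x) (n x) := by
  classical
  obtain ⟨hs₀, hnd₀, hinj₀, hrad₀, hli₀, hcompl₀⟩ := h.self_of_nhds
  obtain ⟨ξ₀, n₀, h₀⟩ := exists_isNullTransversalPair hs₀ hnd₀ hinj₀ hrad₀ hcompl₀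
  let L : P → (Fin k → ℝ) → E := fun x c => ∑ j, c j • X j x
  -- Pointwise existence gives no regularity in `x`. Instead `ξ₀`, `n₀` are frozen at `x₀` and
  -- projected off the screen by inverting the Gram matrix of the frame.
  let gram : P → (Fin k → ℝ) →L[ℝ] (Fin k → ℝ) := fun x =>
    ∑ i, ∑ j, (b x (A x (X i x)) (A x (X j x))) •
      (ContinuousLinearMap.proj (R := ℝ) (φ := fun _ : Fin k => ℝ) j).smulRight
        (Pi.single i (1 : ℝ) : Fin k → ℝ)
  have hgram : ∀ x c i, gram x c i = b x (A x (X i x)) (A x (L x c)) := by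
    intro x c i
    simp [gram, L, Finset.sum_apply, Pi.single_apply, mul_comm]
  have hgramd : DifferentiableAt ℝ gram x₀ := by
    refine DifferentiableAt.fun_sum fun i _ => DifferentiableAt.fun_sum fun j _ => ?_
    have h1 := (hb.clm_apply (hA.clm_apply (hX i))).clm_apply (hA.clm_apply (hX j))
    exact h1.smul_const _
  have hLmem : ∀ x c, L x c ∈ Submodule.span ℝ (Set.range fun i => X i x) := fun x c =>
    Submodule.sum_mem _ fun i _ => Submodule.smul_mem _ _ (Submodule.subset_span ⟨i, rfl⟩)
  have horth : ∀ x v, (∀ i, b x (A x (X i x)) v = 0) →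
      ∀ w ∈ Submodule.span ℝ (Set.range fun i => X i x), b x (A x w) v = 0 := by
    intro x v hv w hw
    induction hw using Submodule.span_induction with
    | mem w hw => obtain ⟨i, rfl⟩ := hw; exact hv i
    | zero => simp
    | add w w' _ _ h h' => simp [h, h']
    | smul a w _ h => simp [h]
  -- A kernel vector of the Gram matrix gives a screen vector orthogonal to the screen and to the
  -- radical, hence in their zero intersection.
  have hgrami : ∀ᶠ x in 𝓝 x₀, (gram x).IsInvertible := by
    filter_upwards [h] with x ⟨hs, hnd, hinj, hrad, hli, hcompl⟩
    refine isInvertible_of_injective ?_ rfl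
    rw [injective_iff_map_eq_zero]
    intro c hc
    have h1 : ∀ i, b x (A x (X i x)) (A x (L x c)) = 0 := fun i => by rw [← hgram, hc]; rfl
    have h2 : L x c ∈ radical (pullbackForm (b x) (A x)) := by
      refine mem_radical_iff.2 fun w => ?_
      obtain ⟨r, hr, s, hs', rfl⟩ := Submodule.mem_sup.1 (hcompl.sup_eq_top ▸ Submodule.mem_top :
        w ∈ radical (pullbackForm (b x) (A x)) ⊔ Submodule.span ℝ (Set.range fun i => X i x))
      have h3 := mem_radical_iff.1 hr (L x c)
      rw [pullbackForm_apply] at h3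
      rw [pullbackForm_apply, hs, map_add, map_add, _root_.add_apply, h3, horth x _ h1 s hs',
        add_zero]
    have h3 : L x c = 0 := by simpa using hcompl.disjoint.le_bot ⟨h2, hLmem x c⟩
    exact funext (Fintype.linearIndependent_iff.1 hli c h3)
  let coef : P → F → Fin k → ℝ := fun x v => (gram x).inverse fun i => b x (A x (X i x)) v
  have hcoef : ∀ {v : P → F}, DifferentiableAt ℝ v x₀ →
      DifferentiableAt ℝ (fun x => L x (coef x (v x))) x₀ := by
    intro v hv
    have h1 : DifferentiableAt ℝ (fun x i => b x (A x (X i x)) (v x)) x₀ :=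
      differentiableAt_pi.2 fun i => (hb.clm_apply (hA.clm_apply (hX i))).clm_apply hv
    have h2 : DifferentiableAt ℝ (fun x => coef x (v x)) x₀ :=
      (differentiableAt_inverse hgramd hgrami.self_of_nhds).clm_apply h1
    exact DifferentiableAt.fun_sum fun i _ => (differentiableAt_pi.1 h2 i).smul (hX i)
  have hcoef₀ : ∀ v, (∀ i, b x₀ (A x₀ (X i x₀)) v = 0) → L x₀ (coef x₀ v) = 0 := by
    intro v hv
    have : coef x₀ v = 0 := by
      simp only [coef, hv]
      exact map_zero _
    simp [L, this]
  let ξ : P → E := fun x => ξ₀ - L x (coef x (A x ξ₀))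
  let m : P → F := fun x => n₀ - A x (L x (coef x n₀))
  let r : P → ℝ := fun x => b x (m x) (A x (ξ x))
  have hξ : DifferentiableAt ℝ ξ x₀ :=
    (differentiableAt_const _).sub (hcoef (hA.clm_apply (differentiableAt_const _)))
  have hm : DifferentiableAt ℝ m x₀ :=
    (differentiableAt_const _).sub (hA.clm_apply (hcoef (differentiableAt_const _)))
  have hr : DifferentiableAt ℝ r x₀ := (hb.clm_apply hm).clm_apply (hA.clm_apply hξ)
  have hXmem : ∀ x i, X i x ∈ Submodule.span ℝ (Set.range fun i => X i x) := fun x i =>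
    Submodule.subset_span ⟨i, rfl⟩
  have hr₀ : r x₀ = 1 := by
    simp only [r, m, ξ]
    rw [hcoef₀ n₀ fun i => by rw [hs₀, h₀.orthogonal _ (hXmem x₀ i)],
      hcoef₀ (A x₀ ξ₀) fun i => by rw [hs₀, h₀.mem_radical]]
    simp [h₀.normalized]
  have hrne : ∀ᶠ x in 𝓝 x₀, r x ≠ 0 := hr.continuousAt.eventually_ne (by simp [hr₀])
  -- Dividing `m` by `r = b(m, A ξ)` normalises it; the second term subtracts half its new square,
  -- `b(m, m) / r²`, to make it null.
  refine ⟨ξ, fun x => (r x)⁻¹ • m x - (1 / 2 * ((r x)⁻¹ * (r x)⁻¹) * b x (m x) (m x)) • A x (ξ x),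
    ?_, ?_⟩
  · have h1 : DifferentiableAt ℝ (fun x => (r x)⁻¹) x₀ := hr.inv hrne.self_of_nhds
    have h2 : DifferentiableAt ℝ (fun x => b x (m x) (m x)) x₀ := (hb.clm_apply hm).clm_apply hm
    exact (h1.smul hm).sub ((((h1.mul h1).const_mul (1 / 2)).mul h2).smul (hA.clm_apply hξ))
  · filter_upwards [h, hgrami, hrne] with x ⟨hs, hnd, hinj, hrad, hli, hcompl⟩ hgi hrx
    have hproj : ∀ v i, b x (A x (X i x)) (v - A x (L x (coef x v))) = 0 := by
      intro v i
      rw [map_sub, ← hgram]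
      have : gram x (coef x v) = fun i => b x (A x (X i x)) v :=
        ((hgi.inverse_apply_eq (y := fun i => b x (A x (X i x)) v)).1 rfl).symm
      rw [this, sub_self]
    have hξS : ∀ w ∈ Submodule.span ℝ (Set.range fun i => X i x), b x (A x w) (A x (ξ x)) = 0 :=
      horth x _ fun i => by
        have := hproj (A x ξ₀) i
        rwa [← map_sub] at this
    have hmS : ∀ w ∈ Submodule.span ℝ (Set.range fun i => X i x), b x (A x w) (m x) = 0 :=
      horth x _ fun i => hproj n₀ i
    -- Although the frozen `ξ₀` need not be radical at `x`, its projection is: it is orthogonal to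
    -- the screen, and to the radical automatically.
    have hξr : ∀ w, b x (A x (ξ x)) (A x w) = 0 := by
      intro w
      obtain ⟨u, hu, s, hs', rfl⟩ := Submodule.mem_sup.1 (hcompl.sup_eq_top ▸ Submodule.mem_top :
        w ∈ radical (pullbackForm (b x) (A x)) ⊔ Submodule.span ℝ (Set.range fun i => X i x))
      have h3 : b x (A x u) (A x (ξ x)) = 0 := mem_radical_iff.1 hu (ξ x)
      rw [hs, map_add, map_add, _root_.add_apply, h3, hξS s hs', add_zero]
    have hrx' : b x (m x) (A x (ξ x)) = r x := rfl
    refine ⟨hξr, ?_, fun s hs' => ?_, ?_⟩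
    · simp only [map_sub, map_smul, _root_.sub_apply, _root_.smul_apply, smul_eq_mul, hrx', hξr,
        hs (A x (ξ x)) (m x)]
      field_simp
      ring
    · rw [hs]
      simp [hξS s hs', hmS s hs']
    · simp [hrx', hξr, hrx]

/-- Its values on the image of `A` and on `n` determine `τ`: it is the first component of the
inverse of `(w, t) ↦ A w + t n`, and inversion is smooth at invertible maps. -/
theorem differentiableAt_tangentialProjection {b : P → F →L[ℝ] F →L[ℝ] ℝ} {A : P → E →L[ℝ] F}
    {S : P → Submodule ℝ E} {ξ : P → E} {n : P → F} {τ : P → F →L[ℝ] E} {x₀ : P}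
    (hA : DifferentiableAt ℝ A x₀) (hn : DifferentiableAt ℝ n x₀)
    (hdim : finrank ℝ F = finrank ℝ E + 1)
    (h : ∀ᶠ x in 𝓝 x₀, (∀ v w, b x v w = b x w v) ∧ Function.Injective (A x) ∧
      IsNullTransversalPair (b x) (A x) (S x) (ξ x) (n x) ∧ (∀ v, τ x (A x v) = v) ∧
      τ x (n x) = 0) : DifferentiableAt ℝ τ x₀ := by
  let Φ : P → E × ℝ →L[ℝ] F := fun x =>
    A x ∘L ContinuousLinearMap.fst ℝ E ℝ + (ContinuousLinearMap.smulRightL ℝ (E × ℝ) F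
      (ContinuousLinearMap.snd ℝ E ℝ)) (n x)
  have hΦ : DifferentiableAt ℝ Φ x₀ := by
    have h1 : DifferentiableAt ℝ (fun x => (ContinuousLinearMap.smulRightL ℝ (E × ℝ) F
        (ContinuousLinearMap.snd ℝ E ℝ)) (n x)) x₀ :=
      (ContinuousLinearMap.differentiableAt _).comp x₀ hn
    exact (hA.clm_comp (differentiableAt_const _)).add h1
  have hΦi : ∀ᶠ x in 𝓝 x₀, (Φ x).IsInvertible := by
    filter_upwards [h] with x ⟨hs, hinj, hp, _⟩
    refine isInvertible_of_injective ?_ (by simp [hdim])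
    have := (hp.coprod_bijective hs hinj hdim).1
    exact this
  have h2 : DifferentiableAt ℝ (fun x => ContinuousLinearMap.fst ℝ E ℝ ∘L (Φ x).inverse) x₀ :=
    (differentiableAt_const _).clm_comp (differentiableAt_inverse hΦ hΦi.self_of_nhds)
  refine h2.congr_of_eventuallyEq ?_
  filter_upwards [h, hΦi] with x ⟨_, _, _, h3, h4⟩ hi
  ext v
  have h5 := (hi.inverse_apply_eq (y := v)).1 rfl
  obtain ⟨p, rfl⟩ : ∃ p, Φ x p = v := ⟨_, h5.symm⟩
  rw [ContinuousLinearMap.comp_apply, (hi.inverse_apply_eq (x := p)).2 rfl]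
  simp [Φ, h3, h4]

end SmoothTransversal

/-! ### Invariance of the hyperplane data under linear isomorphisms. -/

section Transport

variable {V W V' W' : Type*} [AddCommGroup V] [Module ℝ V] [TopologicalSpace V]
  [AddCommGroup W] [Module ℝ W] [TopologicalSpace W] [AddCommGroup V'] [Module ℝ V']
  [TopologicalSpace V'] [AddCommGroup W'] [Module ℝ W'] [TopologicalSpace W']
  {b : V →L[ℝ] V →L[ℝ] ℝ} {A : W →L[ℝ] V} {b' : V' →L[ℝ] V' →L[ℝ] ℝ} {A' : W' →L[ℝ] V'}
  {κ : W ≃L[ℝ] W'} {μ : V ≃L[ℝ] V'}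

theorem radical_pullbackForm_transport (hb : ∀ v w, b' (μ v) (μ w) = b v w)
    (hA : ∀ w, A' (κ w) = μ (A w)) :
    radical (pullbackForm b' A') = (radical (pullbackForm b A)).map κ.toLinearEquiv.toLinearMap := by
  ext v
  obtain ⟨v, rfl⟩ := κ.surjective v
  constructor
  · intro hv
    refine ⟨v, mem_radical_iff.2 fun w => ?_, rfl⟩
    simpa [hA, hb] using mem_radical_iff.1 hv (κ w)
  · rintro ⟨v', hv', h⟩
    obtain rfl : v' = v := κ.injective h
    refine mem_radical_iff.2 fun w => ?_
    obtain ⟨w, rfl⟩ := κ.surjective w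
    simpa [hA, hb] using mem_radical_iff.1 hv' w

theorem finrank_radical_transport (hb : ∀ v w, b' (μ v) (μ w) = b v w)
    (hA : ∀ w, A' (κ w) = μ (A w)) :
    finrank ℝ (radical (pullbackForm b' A')) = finrank ℝ (radical (pullbackForm b A)) := by
  rw [radical_pullbackForm_transport hb hA]
  exact LinearEquiv.finrank_map_eq κ.toLinearEquiv _

theorem isCompl_radical_transport (hb : ∀ v w, b' (μ v) (μ w) = b v w)
    (hA : ∀ w, A' (κ w) = μ (A w)) {S : Submodule ℝ W}
    (hS : IsCompl (radical (pullbackForm b A)) S) :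
    IsCompl (radical (pullbackForm b' A')) (S.map κ.toLinearEquiv.toLinearMap) := by
  rw [radical_pullbackForm_transport hb hA]
  exact hS.map (Submodule.orderIsoMapComap κ.toLinearEquiv)

theorem IsNullTransversalPair.transport (hb : ∀ v w, b' (μ v) (μ w) = b v w)
    (hA : ∀ w, A' (κ w) = μ (A w)) {S : Submodule ℝ W} {ξ : W'} {n : V'}
    (h : IsNullTransversalPair b' A' (S.map κ.toLinearEquiv.toLinearMap) ξ n) :
    IsNullTransversalPair b A S (κ.symm ξ) (μ.symm n) where
  mem_radical w := by
    rw [← hb, ← hA, ← hA]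
    simpa using h.mem_radical (κ w)
  null := by
    rw [← hb]
    simpa using h.null
  orthogonal s hs := by
    rw [← hb, ← hA]
    simpa using h.orthogonal (κ s) ⟨s, hs, rfl⟩
  normalized := by
    rw [← hb, ← hA]
    simpa using h.normalized

end Transport

/-! ### Tangent spaces, metrics and maps read in preferred charts. -/

section Charts

theorem eventually_chartAt_symm {E M : Type*} [TopologicalSpace E] [TopologicalSpace M]
    [ChartedSpace E M] {p : M} {P : M → E → Prop}
    (h : ∀ᶠ q in 𝓝 p, P q (chartAt E p q)) :
    ∀ᶠ x in 𝓝 (chartAt E p p), P ((chartAt E p).symm x) x := by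
  have h1 : Filter.Tendsto (chartAt E p).symm (𝓝 (chartAt E p p)) (𝓝 p) := by
    have := (chartAt E p).continuousAt_symm (mem_chart_target E p)
    rwa [ContinuousAt, (chartAt E p).left_inv (mem_chart_source E p)] at this
  filter_upwards [h1.eventually h,
    (chartAt E p).open_target.mem_nhds (mem_chart_target E p)] with x hx hx'
  rwa [(chartAt E p).right_inv hx'] at hx

variable {E : Type*} [NormedAddCommGroup E] [NormedSpace ℝ E]
  {F : Type*} [NormedAddCommGroup F] [NormedSpace ℝ F]
  {M : Type*} [TopologicalSpace M] [ChartedSpace E M]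
  {N : Type*} [TopologicalSpace N] [ChartedSpace F N]

theorem contDiffAt_mapInChart {f : M → N} (hf : ContMDiff 𝓘(ℝ, E) 𝓘(ℝ, F) ∞ f) (p : M) :
    ContDiffAt ℝ ∞ (ScreenDistribution.mapInChart (E := E) (F := F) f p) (chartAt E p p) := by
  have := (contMDiffAt_iff.1 (hf p)).2
  simp only [modelWithCornersSelf_coe, Set.range_id, contDiffWithinAt_univ] at this
  exact this

variable [IsManifold 𝓘(ℝ, E) ∞ M] [IsManifold 𝓘(ℝ, F) ∞ N]

/-- The derivative at `q` of the preferred chart at `p`. -/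
def tangentChart (p : M) {q : M} (hq : q ∈ (chartAt E p).source) :
    TangentSpace 𝓘(ℝ, E) q ≃L[ℝ] E :=
  (mdifferentiable_chart (I := 𝓘(ℝ, E)) p).mfderiv hq

/-- The fibre at `p` is modelled on `E` through the preferred chart at `p`, so this derivative is a
trivial coordinate change; tensors computed in that chart need no correction at `p`. -/
theorem mfderiv_chartAt_self_apply (p : M) (v : TangentSpace 𝓘(ℝ, E) p) :
    (mfderiv 𝓘(ℝ, E) 𝓘(ℝ, E) (chartAt E p) p v : E) = v := by
  rw [mfderiv_chartAt_eq_tangentCoordChange (mem_chart_source E p)]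
  exact tangentCoordChange_self (I := 𝓘(ℝ, E)) (by simp)

theorem tangentChart_self (p : M) (v : TangentSpace 𝓘(ℝ, E) p) :
    tangentChart p (mem_chart_source E p) v = (v : E) :=
  mfderiv_chartAt_self_apply p v

theorem mfderiv_chartAt_symm_tangentChart (p : M) {y : E} (hy : y ∈ (chartAt E p).target)
    (v : TangentSpace 𝓘(ℝ, E) ((chartAt E p).symm y)) :
    mfderiv 𝓘(ℝ, E) 𝓘(ℝ, E) (chartAt E p).symm y
      (tangentChart p ((chartAt E p).map_target hy) v : E) = v := by
  have hq := (chartAt E p).map_target hy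
  have h1 := ((mdifferentiable_chart (I := 𝓘(ℝ, E)) p).mfderiv hq).symm_apply_apply v
  -- The base points agree only propositionally, so the derivatives are compared on vectors of `E`
  -- after generalising the point.
  have h2 : ∀ y', y' = y → ∀ w : E, (mfderiv 𝓘(ℝ, E) 𝓘(ℝ, E) (chartAt E p).symm y' w : E) =
      (mfderiv 𝓘(ℝ, E) 𝓘(ℝ, E) (chartAt E p).symm y w : E) := by
    rintro _ rfl w; rfl
  exact (h2 _ ((chartAt E p).right_inv hy) _).symm.trans h1

theorem metricInChart_tangentChart
    (g : ∀ q : M, TangentSpace 𝓘(ℝ, E) q →L[ℝ] TangentSpace 𝓘(ℝ, E) q →L[ℝ] ℝ) (p : M) {q : M}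
    (hq : q ∈ (chartAt E p).source) (v w : TangentSpace 𝓘(ℝ, E) q) :
    metricInChart g p (chartAt E p q) (tangentChart p hq v) (tangentChart p hq w) = g q v w := by
  obtain ⟨y, hy, rfl⟩ : ∃ y ∈ (chartAt E p).target, (chartAt E p).symm y = q :=
    ⟨_, (chartAt E p).map_source hq, (chartAt E p).left_inv hq⟩
  rw [(chartAt E p).right_inv hy]
  have h := mfderiv_chartAt_symm_tangentChart p hy
  exact congrArg₂ (fun a b => g _ a b) (h v) (h w)

theorem metricInChart_self
    (g : ∀ q : M, TangentSpace 𝓘(ℝ, E) q →L[ℝ] TangentSpace 𝓘(ℝ, E) q →L[ℝ] ℝ) (p : M) (v w : E) :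
    metricInChart g p (chartAt E p p) v w = g p v w := by
  have := metricInChart_tangentChart g p (mem_chart_source E p) v w
  exact (congrArg₂ (fun a b : E => metricInChart g p (chartAt E p p) a b) (tangentChart_self p v)
    (tangentChart_self p w)).symm.trans this

theorem fderiv_mapInChart_tangentChart {f : M → N} (p : M) {q : M}
    (hq : q ∈ (chartAt E p).source) (hfq : f q ∈ (chartAt F (f p)).source)
    (hf : MDifferentiableAt 𝓘(ℝ, E) 𝓘(ℝ, F) f q) (v : TangentSpace 𝓘(ℝ, E) q) :
    fderiv ℝ (ScreenDistribution.mapInChart (E := E) (F := F) f p) (chartAt E p q) (tangentChart p hq v) =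
      tangentChart (f p) hfq (mfderiv 𝓘(ℝ, E) 𝓘(ℝ, F) f q v) := by
  obtain ⟨y, hy, rfl⟩ : ∃ y ∈ (chartAt E p).target, (chartAt E p).symm y = q :=
    ⟨_, (chartAt E p).map_source hq, (chartAt E p).left_inv hq⟩
  rw [(chartAt E p).right_inv hy]
  have h1 := ((mdifferentiable_chart (I := 𝓘(ℝ, E)) p).mdifferentiableAt_symm hy).hasMFDerivAt
  have h2 := HasMFDerivAt.comp y hf.hasMFDerivAt h1
  have h3 := HasMFDerivAt.comp y
    ((mdifferentiable_chart (I := 𝓘(ℝ, F)) (f p)).mdifferentiableAt hfq).hasMFDerivAt h2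
  have h4 := HasFDerivAt.fderiv (𝕜 := ℝ) (E := E) (F := F)
    (f := ScreenDistribution.mapInChart (E := E) (F := F) f p) h3.hasFDerivAt
  refine (congrArg (fun L : E →L[ℝ] F => L (tangentChart p hq v)) h4).trans ?_
  have h := mfderiv_chartAt_symm_tangentChart p hy v
  exact congrArg (fun a => (mfderiv 𝓘(ℝ, F) 𝓘(ℝ, F) (chartAt F (f p)) (f ((chartAt E p).symm y))
    (mfderiv 𝓘(ℝ, E) 𝓘(ℝ, F) f ((chartAt E p).symm y) a) : F)) h

theorem fderiv_mapInChart_self {f : M → N} (p : M) (hf : MDifferentiableAt 𝓘(ℝ, E) 𝓘(ℝ, F) f p)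
    (v : E) : fderiv ℝ (ScreenDistribution.mapInChart (E := E) (F := F) f p) (chartAt E p p) v =
      (mfderiv 𝓘(ℝ, E) 𝓘(ℝ, F) f p v : F) := by
  have := fderiv_mapInChart_tangentChart p (mem_chart_source E p) (mem_chart_source F (f p)) hf v
  rw [tangentChart_self] at this
  exact (congrArg (fun a : E => fderiv ℝ (ScreenDistribution.mapInChart (E := E) (F := F) f p)
    (chartAt E p p) a) (tangentChart_self p v)).symm.trans this

/-- The expression in a chart of a smooth vector field is differentiable. -/
theorem differentiableAt_vectorField_inChart {X : ∀ q : M, TangentSpace 𝓘(ℝ, E) q} {U : Set M}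
    (hU : IsOpen U) {p : M} (hp : p ∈ U)
    (hX : ContMDiffOn 𝓘(ℝ, E) 𝓘(ℝ, E).tangent ∞
      (fun q => (⟨q, X q⟩ : TangentBundle 𝓘(ℝ, E) M)) U) :
    DifferentiableAt ℝ (fun x : E => (mfderiv 𝓘(ℝ, E) 𝓘(ℝ, E) (chartAt E p)
      ((chartAt E p).symm x) (X ((chartAt E p).symm x)) : E)) (chartAt E p p) := by
  have h1 := (Bundle.contMDiffAt_section (IB := 𝓘(ℝ, E)) p).1
    ((hX p hp).contMDiffAt (hU.mem_nhds hp))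
  have h2 : ContMDiffAt 𝓘(ℝ, E) 𝓘(ℝ, E) ∞ (chartAt E p).symm (chartAt E p p) :=
    (contMDiffOn_chart_symm (I := 𝓘(ℝ, E)) (n := ∞) (x := p)).contMDiffAt
      ((chartAt E p).open_target.mem_nhds (mem_chart_target E p))
  have h3 : ContMDiffAt 𝓘(ℝ, E) 𝓘(ℝ, E) ∞
      ((fun q => (trivializationAt E (TangentSpace 𝓘(ℝ, E)) p ⟨q, X q⟩).2) ∘ (chartAt E p).symm)
      (chartAt E p p) := by
    refine ContMDiffAt.comp _ ?_ h2
    rwa [(chartAt E p).left_inv (mem_chart_source E p)]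
  refine (h3.contDiffAt.differentiableAt (by simp)).congr_of_eventuallyEq ?_
  have := eventually_chartAt_symm (p := p) (P := fun q (_ : E) => q ∈ (chartAt E p).source)
    ((chartAt E p).open_source.mem_nhds (mem_chart_source E p))
  filter_upwards [this] with x hx
  have h4 := TangentBundle.continuousLinearMapAt_trivializationAt (I := 𝓘(ℝ, E)) hx
  have h5 := Bundle.Trivialization.continuousLinearMapAt_apply_of_mem (R := ℝ)
    (trivializationAt E (TangentSpace 𝓘(ℝ, E)) p) (by simpa using hx) (X ((chartAt E p).symm x))
  exact (DFunLike.congr_fun h4 _).symm.trans h5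

end Charts

open ScreenDistribution

theorem metricInChart_mapInChart {E F M N : Type*} [NormedAddCommGroup E] [NormedAddCommGroup F]
    [NormedSpace ℝ F] [TopologicalSpace M] [ChartedSpace E M] [TopologicalSpace N]
    [ChartedSpace F N] [IsManifold 𝓘(ℝ, F) ∞ N] {f : M → N}
    (g : SemiRiemannianMetric F N) (p : M) {q : M}
    (hq : q ∈ (chartAt E p).source) (hfq : f q ∈ (chartAt F (f p)).source)
    (v w : TangentSpace 𝓘(ℝ, F) (f q)) :
    metricInChart g.form (f p) (mapInChart (E := E) f p (chartAt E p q))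
      (tangentChart (f p) hfq v) (tangentChart (f p) hfq w) = g.form (f q) v w := by
  rw [mapInChart, (chartAt E p).left_inv hq]
  exact metricInChart_tangentChart g.form (f p) hfq v w

/-! ### Transversal bundle and tangential projection of a screen in charts. -/

section Hypersurface

variable {E : Type*} [NormedAddCommGroup E] [NormedSpace ℝ E]
  {F : Type*} [NormedAddCommGroup F] [NormedSpace ℝ F]
  {M : Type*} [TopologicalSpace M] [ChartedSpace E M] [IsManifold 𝓘(ℝ, E) ∞ M]
  {N : Type*} [TopologicalSpace N] [ChartedSpace F N]
  {g : SemiRiemannianMetric F N} {f : M → N}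

instance {H : Type*} [TopologicalSpace H] [ChartedSpace E H] [h : FiniteDimensional ℝ E] (q : H) :
    FiniteDimensional ℝ (TangentSpace 𝓘(ℝ, E) q) := h

theorem ScreenDistribution.isNormalizingPair_iff {S : ScreenDistribution (E := E) g f} {p : M}
    {ξ : TangentSpace 𝓘(ℝ, E) p} {n : TangentSpace 𝓘(ℝ, F) (f p)} :
    S.IsNormalizingPair p ξ n ↔
      IsNullTransversalPair (g.form (f p)) (mfderiv 𝓘(ℝ, E) 𝓘(ℝ, F) f p) (S.space p) ξ n :=
  ⟨fun h => ⟨mem_radical_iff.1 h.mem_radical, h.null, h.orthogonal, h.normalized⟩,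
    fun h => ⟨mem_radical_iff.2 h.mem_radical, h.null, h.orthogonal, h.normalized⟩⟩

section

variable [FiniteDimensional ℝ E] [FiniteDimensional ℝ F]

theorem ScreenDistribution.exists_isNormalizingPair (hf : IsLightlikeHypersurface (E := E) g f)
    (S : ScreenDistribution (E := E) g f) (p : M) : ∃ ξ n, S.IsNormalizingPair p ξ n := by
  simp only [isNormalizingPair_iff]
  exact exists_isNullTransversalPair (g.symm _) (g.nondegenerate _) (hf.immersive p)
    (hf.finrank_radical p) (S.isCompl p)

/-- The projection is an `epsilon` choice, so a witness is needed. One normalizing pair supplies it;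
by `mem_span` every other null transversal vector is a multiple of the same `n`. -/
theorem ScreenDistribution.tangentialProjection_spec (hf : IsLightlikeHypersurface (E := E) g f)
    (S : ScreenDistribution (E := E) g f) (p : M) :
    (∀ v, S.tangentialProjection p (mfderiv 𝓘(ℝ, E) 𝓘(ℝ, F) f p v) = v) ∧
      ∀ n ∈ S.ltr p, S.tangentialProjection p n = 0 := by
  refine Classical.epsilon_spec (p := fun τ : TangentSpace 𝓘(ℝ, F) (f p) →L[ℝ]
    TangentSpace 𝓘(ℝ, E) p => (∀ v, τ (mfderiv 𝓘(ℝ, E) 𝓘(ℝ, F) f p v) = v) ∧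
      ∀ n ∈ S.ltr p, τ n = 0) ?_
  obtain ⟨ξ, n, hp⟩ := S.exists_isNormalizingPair hf p
  have hp' := isNormalizingPair_iff.1 hp
  have hbij := hp'.coprod_bijective (g.symm _) (hf.immersive p) hf.codimension_one
  let Φ := LinearEquiv.ofBijective _ hbij
  let τ : F →L[ℝ] E := LinearMap.toContinuousLinearMap (𝕜 := ℝ) (E := F) (F' := E)
    (LinearMap.fst ℝ (TangentSpace 𝓘(ℝ, E) p) ℝ ∘ₗ Φ.symm.toLinearMap)
  have hτ : ∀ (w : TangentSpace 𝓘(ℝ, E) p) (t : ℝ), τ (mfderiv 𝓘(ℝ, E) 𝓘(ℝ, F) f p w + t • n) = w := by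
    intro w t
    have h1 : Φ (w, t) = mfderiv 𝓘(ℝ, E) 𝓘(ℝ, F) f p w + t • n := by
      simp [Φ]
    have h2 : (Φ.symm (Φ (w, t))).1 = w := by rw [Φ.symm_apply_apply]
    rw [h1] at h2
    exact h2
  refine ⟨τ, fun v => ?_, fun m hm => ?_⟩
  · have := hτ v 0
    rwa [zero_smul, add_zero] at this
  · induction hm using Submodule.span_induction with
    | mem m hm =>
      obtain ⟨ξ', hm⟩ := hm
      obtain ⟨a, rfl⟩ := hp'.mem_span (isNormalizingPair_iff.1 hm) (g.symm _) (hf.immersive p)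
        hf.codimension_one (hf.finrank_radical p) (S.isCompl p)
      have := hτ 0 a
      rwa [map_zero, zero_add] at this
    | zero => exact map_zero τ
    | add m m' _ _ h h' => exact (map_add τ m m').trans ((congrArg₂ (· + ·) h h').trans (add_zero _))
    | smul a m _ h => exact (map_smul τ a m).trans ((congrArg (fun z : E => a • z) h).trans (smul_zero (A := E) a))

end

variable [IsManifold 𝓘(ℝ, F) ∞ N]

/-- In charts, the tangential projection is a left inverse of the derivative of the immersion that
vanishes on null transversal vectors. -/
theorem tangentialProjectionInChart_apply (S : ScreenDistribution (E := E) g f) (p : M) {q : M}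
    (hq : q ∈ (chartAt E p).source) (hfq : f q ∈ (chartAt F (f p)).source)
    (v : TangentSpace 𝓘(ℝ, F) (f q)) :
    S.tangentialProjectionInChart p (chartAt E p q) (tangentChart (f p) hfq v) =
      tangentChart p hq (S.tangentialProjection q v) := by
  obtain ⟨y, hy, rfl⟩ : ∃ y ∈ (chartAt E p).target, (chartAt E p).symm y = q :=
    ⟨_, (chartAt E p).map_source hq, (chartAt E p).left_inv hq⟩
  rw [(chartAt E p).right_inv hy, tangentialProjectionInChart]
  have h : (mfderiv 𝓘(ℝ, F) 𝓘(ℝ, F) (chartAt F (f p)) (f ((chartAt E p).symm y)) :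
      TangentSpace 𝓘(ℝ, F) (f ((chartAt E p).symm y)) →L[ℝ] F).inverse
        (tangentChart (f p) hfq v) = v := by
    exact (DFunLike.congr_fun (ContinuousLinearMap.inverse_equiv (tangentChart (f p) hfq)) _).trans
      ((tangentChart (f p) hfq).symm_apply_apply v)
  exact congrArg (fun a => (mfderiv 𝓘(ℝ, E) 𝓘(ℝ, E) (chartAt E p) ((chartAt E p).symm y)
    (S.tangentialProjection ((chartAt E p).symm y) a) : E)) h

variable [FiniteDimensional ℝ E] [FiniteDimensional ℝ F]

/-- Near a point, a screen distribution has null transversal vectors depending differentiably on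
the point, and the tangential projection is the projection along them. -/
theorem exists_differentiableAt_transversal (hf : IsLightlikeHypersurface (E := E) g f)
    (S : ScreenDistribution (E := E) g f) (p : M) :
    ∃ (T : E → Submodule ℝ E) (ξ : E → E) (n : E → F), DifferentiableAt ℝ n (chartAt E p p) ∧
      S.IsNormalizingPair p (ξ (chartAt E p p)) (n (chartAt E p p)) ∧
      ∀ᶠ x in 𝓝 (chartAt E p p),
      (∀ v w, metricInChart g.form (f p) (mapInChart f p x) v w =
        metricInChart g.form (f p) (mapInChart f p x) w v) ∧
      Function.Injective (fderiv ℝ (mapInChart (E := E) (F := F) f p) x) ∧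
      IsNullTransversalPair (metricInChart g.form (f p) (mapInChart f p x))
        (fderiv ℝ (mapInChart f p) x) (T x) (ξ x) (n x) ∧
      (∀ v, S.tangentialProjectionInChart p x (fderiv ℝ (mapInChart f p) x v) = v) ∧
      S.tangentialProjectionInChart p x (n x) = 0 := by
  obtain ⟨U, hU, hpU, k, X, hX, hXS⟩ := S.smooth p
  have hsrc : ∀ᶠ q in 𝓝 p, q ∈ U ∧ q ∈ (chartAt E p).source ∧ f q ∈ (chartAt F (f p)).source :=
    Filter.Eventually.and (hU.mem_nhds hpU) (Filter.Eventually.and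
      ((chartAt E p).open_source.mem_nhds (mem_chart_source E p))
      (hf.smooth.continuous.continuousAt.eventually
        ((chartAt F (f p)).open_source.mem_nhds (mem_chart_source F (f p)))))
  have hfd : ∀ q, MDifferentiableAt 𝓘(ℝ, E) 𝓘(ℝ, F) f q := hf.smooth.mdifferentiable (by simp)
  let Y : Fin k → ∀ q : M, E := fun i q => mfderiv 𝓘(ℝ, E) 𝓘(ℝ, E) (chartAt E p) q (X i q)
  have hspan : ∀ q ∈ U, ∀ hq : q ∈ (chartAt E p).source,
      Submodule.span ℝ (Set.range fun i => Y i q) =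
        (S.space q).map (tangentChart p hq).toLinearEquiv.toLinearMap := by
    intro q hqU hq
    rw [(hXS q hqU).2, Submodule.map_span, ← Set.range_comp]
    rfl
  have hφ := contDiffAt_mapInChart hf.smooth p
  have hφ1 : DifferentiableAt ℝ (fderiv ℝ (mapInChart (E := E) (F := F) f p)) (chartAt E p p) :=
    differentiableAt_fderiv_of_contDiffAt hφ
  have hφp : mapInChart (E := E) (F := F) f p (chartAt E p p) = chartAt F (f p) (f p) := by
    rw [mapInChart, (chartAt E p).left_inv (mem_chart_source E p)]
  have hG : ContDiffAt ℝ ∞ (metricInChart g.form (f p)) (mapInChart f p (chartAt E p p)) := by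
    rw [hφp]
    exact (g.smooth (f p)).contDiffAt
      ((chartAt F (f p)).open_target.mem_nhds (mem_chart_target F (f p)))
  have hev := eventually_chartAt_symm (E := E) (p := p) (P := fun q x =>
      (∀ v w, metricInChart g.form (f p) (mapInChart f p x) v w =
        metricInChart g.form (f p) (mapInChart f p x) w v) ∧
      (∀ v, (∀ w, metricInChart g.form (f p) (mapInChart f p x) v w = 0) → v = 0) ∧
      Function.Injective (fderiv ℝ (mapInChart (E := E) (F := F) f p) x) ∧
      finrank ℝ (radical (pullbackForm (metricInChart g.form (f p) (mapInChart f p x))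
        (fderiv ℝ (mapInChart f p) x))) = 1 ∧
      LinearIndependent ℝ (fun i => Y i q) ∧
      IsCompl (radical (pullbackForm (metricInChart g.form (f p) (mapInChart f p x))
        (fderiv ℝ (mapInChart f p) x))) (Submodule.span ℝ (Set.range fun i => Y i q))) (by
    filter_upwards [hsrc] with q ⟨hqU, hq, hfq⟩
    have hb := metricInChart_mapInChart (E := E) g p hq hfq
    have hA := fderiv_mapInChart_tangentChart p hq hfq (hfd q)
    refine ⟨fun v w => ?_, fun v hv => ?_, ?_, ?_, ?_, ?_⟩
    · obtain ⟨v, rfl⟩ := (tangentChart (f p) hfq).surjective v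
      obtain ⟨w, rfl⟩ := (tangentChart (f p) hfq).surjective w
      rw [hb, hb, g.symm]
    · obtain ⟨v, rfl⟩ := (tangentChart (f p) hfq).surjective v
      rw [g.nondegenerate _ v fun w => by rw [← hb, hv], map_zero]
    · intro v w hvw
      obtain ⟨v, rfl⟩ := (tangentChart p hq).surjective v
      obtain ⟨w, rfl⟩ := (tangentChart p hq).surjective w
      rw [hA, hA] at hvw
      rw [hf.immersive q ((tangentChart (f p) hfq).injective hvw)]
    · rw [finrank_radical_transport hb hA]
      exact hf.finrank_radical q
    · exact (hXS q hqU).1.map' (tangentChart p hq).toLinearEquiv.toLinearMap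
        (tangentChart p hq).toLinearEquiv.ker
    · rw [hspan q hqU hq]
      exact isCompl_radical_transport hb hA (S.isCompl q))
  obtain ⟨ξ, n, hn, hpair⟩ := exists_differentiableAt_isNullTransversalPair
    (b := fun x => metricInChart g.form (f p) (mapInChart (E := E) f p x))
    (X := fun i x => Y i ((chartAt E p).symm x))
    ((hG.differentiableAt (by simp)).comp (chartAt E p p) (hφ.differentiableAt (by simp))) hφ1
    (fun i => differentiableAt_vectorField_inChart hU hpU (hX i)) hev
  -- Coordinate null transversal vectors come from genuine ones at `q`, so they lie in `ltr` and the
  -- projection kills them.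
  have hback : ∀ {q : M} (x : E), q ∈ U → ∀ (hq : q ∈ (chartAt E p).source)
      (hfq : f q ∈ (chartAt F (f p)).source), chartAt E p q = x →
      IsNullTransversalPair (metricInChart g.form (f p) (mapInChart f p x))
        (fderiv ℝ (mapInChart f p) x) (Submodule.span ℝ (Set.range fun i => Y i q)) (ξ x) (n x) →
      S.IsNormalizingPair q ((tangentChart p hq).symm (ξ x))
        ((tangentChart (f p) hfq).symm (n x)) := by
    rintro q _ hqU hq hfq rfl h
    rw [hspan q hqU hq] at h
    exact isNormalizingPair_iff.2 (h.transport (metricInChart_mapInChart (E := E) g p hq hfq)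
      (fderiv_mapInChart_tangentChart p hq hfq (hfd q)))
  refine ⟨fun x => Submodule.span ℝ (Set.range fun i => Y i ((chartAt E p).symm x)), ξ, n, hn, ?_,
    ?_⟩
  · have h := hpair.self_of_nhds
    rw [(chartAt E p).left_inv (mem_chart_source E p)] at h
    have h1 := hback _ hpU (mem_chart_source E p) (mem_chart_source F (f p)) rfl h
    have h2 : ∀ v : E, (tangentChart p (mem_chart_source E p)).symm v = v := fun v =>
      (tangentChart p (mem_chart_source E p)).symm_apply_eq.2 (tangentChart_self p v).symm
    have h3 : ∀ v : F, (tangentChart (f p) (mem_chart_source F (f p))).symm v = v := fun v =>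
      (tangentChart (f p) (mem_chart_source F (f p))).symm_apply_eq.2
        (tangentChart_self (f p) v).symm
    rwa [h2, h3] at h1
  · have hsrc' := eventually_chartAt_symm (E := E) (p := p) (P := fun q x =>
      (q ∈ U ∧ q ∈ (chartAt E p).source ∧ f q ∈ (chartAt F (f p)).source) ∧ chartAt E p q = x)
      (hsrc.mono fun q hq => ⟨hq, rfl⟩)
    filter_upwards [hev, hpair, hsrc'] with x ⟨hs, _, hinj, _⟩ hx ⟨⟨hqU, hq, hfq⟩, hqx⟩
    refine ⟨hs, hinj, hx, fun v => ?_, ?_⟩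
    · obtain ⟨v, rfl⟩ := (tangentChart p hq).surjective v
      have hA := fderiv_mapInChart_tangentChart p hq hfq (hfd _) v
      have hτ := tangentialProjectionInChart_apply S p hq hfq
      rw [hqx] at hA hτ
      rw [hA, hτ, (S.tangentialProjection_spec hf _).1]
    · have h1 := hback x hqU hq hfq hqx hx
      have hτ := tangentialProjectionInChart_apply S p hq hfq
        ((tangentChart (f p) hfq).symm (n x))
      rw [hqx, ContinuousLinearEquiv.apply_symm_apply,
        (S.tangentialProjection_spec hf _).2 _ (Submodule.subset_span ⟨_, h1⟩), map_zero] at hτ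
      exact hτ

end Hypersurface

section Ambient

variable {F : Type*} [NormedAddCommGroup F] [NormedSpace ℝ F]
  {N : Type*} [TopologicalSpace N] [ChartedSpace F N]

theorem SemiRiemannianMetric.contDiffAt_metricInChart (g : SemiRiemannianMetric F N) (q : N) :
    ContDiffAt ℝ ∞ (metricInChart g.form q) (chartAt F q q) :=
  (g.smooth q).contDiffAt ((chartAt F q).open_target.mem_nhds (mem_chart_target F q))

theorem SemiRiemannianMetric.eventually_metricInChart_symm (g : SemiRiemannianMetric F N) (q : N) :
    ∀ᶠ y in 𝓝 (chartAt F q q), ∀ v w, metricInChart g.form q y v w = metricInChart g.form q y w v :=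
  Filter.Eventually.of_forall fun _ _ _ => g.symm _ _ _

end Ambient

/-! ### The case without unit vectors. -/

section TotallyNull

variable {E : Type*} [NormedAddCommGroup E] [NormedSpace ℝ E]
  {F : Type*} [NormedAddCommGroup F] [NormedSpace ℝ F]
  {M : Type*} [TopologicalSpace M] [ChartedSpace E M] [IsManifold 𝓘(ℝ, E) ∞ M]
  {N : Type*} [TopologicalSpace N] [ChartedSpace F N]
  {g : SemiRiemannianMetric F N} {f : M → N}

/-- A lightlike hypersurface without unit vectors is a curve, hence Einstein. -/
theorem isEinsteinAt_of_pseudoSphere_eq_empty (hf : IsLightlikeHypersurface (E := E) g f) {p : M}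
    (h₁ : pseudoSphere (E := E) g f p 1 = ∅) (h₂ : pseudoSphere (E := E) g f p (-1) = ∅)
    (S : ScreenDistribution (E := E) g f) : S.IsEinsteinAt p := by
  let b : E →L[ℝ] E →L[ℝ] ℝ := inducedMetric (E := E) g f p
  have hb : ∀ x y, b x y = b y x := fun x y => g.symm _ _ _
  have hnull : ∀ x, b x x = 0 := by
    intro x
    by_contra hx
    set r := Real.sqrt |b x x| with hr
    have hr2 : r ^ 2 = |b x x| := Real.sq_sqrt (abs_nonneg _)
    have hr0 : r ≠ 0 := (Real.sqrt_pos.2 (abs_pos.2 hx)).ne'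
    have hrx : b (r⁻¹ • x) (r⁻¹ • x) = (r ^ 2)⁻¹ * b x x := by
      simp only [map_smul, _root_.smul_apply, smul_eq_mul]
      field_simp
    rcases abs_cases (b x x) with ⟨h, -⟩ | ⟨h, -⟩
    · have : (r⁻¹ • x : E) ∈ pseudoSphere (E := E) g f p 1 := by
        refine hrx.trans ?_
        rw [hr2, h, inv_mul_cancel₀ hx]
      rw [h₁] at this
      exact this
    · have : (r⁻¹ • x : E) ∈ pseudoSphere (E := E) g f p (-1) := by
        refine hrx.trans ?_
        rw [hr2, h, inv_neg, neg_mul, inv_mul_cancel₀ hx]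
      rw [h₂] at this
      exact this
  have hzero : ∀ x y, b x y = 0 := by
    intro x y
    have h := hnull (x + y)
    simp only [map_add, _root_.add_apply, hnull, hb y x] at h
    linarith
  have htop : radical b = ⊤ := by
    rw [eq_top_iff]
    exact fun x _ => mem_radical_iff.2 (hzero x)
  have hdim : finrank ℝ E = 1 := by
    rw [← finrank_top ℝ E, ← htop]
    exact hf.finrank_radical p
  -- Curvature is skew in its first two arguments, which are proportional in dimension one.
  have hR : ∀ x z y : E, curvature (S.inducedChristoffel p) (chartAt E p p) x z y = 0 := by
    intro x z y
    by_cases hx : x = 0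
    · simp [hx]
    · obtain ⟨a, rfl⟩ := (finrank_eq_one_iff_of_nonzero' x hx).1 hdim z
      rw [map_smul, _root_.smul_apply, curvature_apply, sub_self, sub_self, add_zero, smul_zero]
  refine ⟨0, fun x y => ?_⟩
  have h1 : (((curvature (S.inducedChristoffel p) (chartAt E p p) x).flip y : E →L[ℝ] E) :
      E →ₗ[ℝ] E) = 0 := by
    ext z
    exact hR x z y
  rw [zero_mul]
  exact (congrArg (LinearMap.trace ℝ E) h1).trans (map_zero _)

end TotallyNull

/-! ### Ambient constant curvature and the Gauss equation on the manifold. -/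

section EinsteinHypersurface

variable {E : Type*} [NormedAddCommGroup E] [NormedSpace ℝ E] [FiniteDimensional ℝ E]
  {F : Type*} [NormedAddCommGroup F] [NormedSpace ℝ F] [FiniteDimensional ℝ F]
  {M : Type*} [TopologicalSpace M] [ChartedSpace E M] [IsManifold 𝓘(ℝ, E) ∞ M]
  {N : Type*} [TopologicalSpace N] [ChartedSpace F N] [IsManifold 𝓘(ℝ, F) ∞ N]
  {g : SemiRiemannianMetric F N} {f : M → N}

theorem SemiRiemannianMetric.isInvertible_metricInChart (g : SemiRiemannianMetric F N) (q : N) :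
    (metricInChart g.form q (chartAt F q q)).IsInvertible :=
  isInvertible_of_nondegenerate fun v hv => g.nondegenerate q v fun w =>
    (metricInChart_self _ _ _ _).symm.trans (hv w)

/-- The curvature tensor of a space of constant sectional curvature at a point whose tangent space
contains a pair of null vectors that are not orthogonal. -/
theorem SemiRiemannianMetric.form_riemann_eq {g : SemiRiemannianMetric F N} {c : ℝ}
    (hc : g.HasConstantSectionalCurvature c) {q : N} {v₀ w₀ : F} (hv : g.form q v₀ v₀ = 0)
    (hvw : g.form q v₀ w₀ = 1) (hw : g.form q w₀ w₀ = 0) (x y z w : F) :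
    metricInChart g.form q (chartAt F q q)
        (curvature (christoffel (metricInChart g.form q)) (chartAt F q q) x y z) w =
      c * (g.form q y z * g.form q x w - g.form q x z * g.form q y w) := by
  have hG := g.contDiffAt_metricInChart q
  have hs := g.eventually_metricInChart_symm q
  have hi := g.isInvertible_metricInChart q
  have hself := metricInChart_self (M := N) g.form q
  have hR : IsAlgebraicCurvature fun x y z w => metricInChart g.form q (chartAt F q q)
      (curvature (christoffel (metricInChart g.form q)) (chartAt F q q) x y z) w :=
    IsAlgebraicCurvature.of_skew
      (fun x y z w => by rw [curvature_skew, map_neg]; rfl)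
      (fun x y z w => form_curvature_skew hG hs hi x y z w)
      (fun x y z w => by
        rw [← _root_.add_apply, ← _root_.add_apply, ← map_add, ← map_add,
          curvature_bianchi hG hs hi, map_zero]
        rfl)
  -- The null pair spans a plane of discriminant `-1`, the nondegenerate plane required here.
  have h := curvature_eq_of_constant_sectional (c := c) hs.self_of_nhds hR ⟨v₀, w₀, by
    rw [hself, hself, hself, hv, hvw, hw]
    norm_num⟩ (fun v w hne => by
      simp only [hself] at hne ⊢
      exact hc q v w hne) x y z w
  rw [h, hself, hself, hself, hself]

set_option maxSynthPendingDepth 4 in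
/-- The Gauss equation of a lightlike hypersurface: the transversal components of the ambient and
of the induced curvature agree. -/
theorem form_inducedCurvature (hf : IsLightlikeHypersurface (E := E) g f)
    (S : ScreenDistribution (E := E) g f) (p : M) :
    ∃ (ξ : E) (n : F), S.IsNormalizingPair p ξ n ∧ ∀ v w z : E,
      metricInChart g.form (f p) (chartAt F (f p) (f p))
        (curvature (christoffel (metricInChart g.form (f p))) (chartAt F (f p) (f p))
          (mfderiv 𝓘(ℝ, E) 𝓘(ℝ, F) f p v : F) (mfderiv 𝓘(ℝ, E) 𝓘(ℝ, F) f p w : F)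
          (mfderiv 𝓘(ℝ, E) 𝓘(ℝ, F) f p z : F)) n =
        g.form (f p) n (mfderiv 𝓘(ℝ, E) 𝓘(ℝ, F) f p (S.inducedCurvature p v w z)) := by
  obtain ⟨T, ξ, n, hn, hpair, hev⟩ := exists_differentiableAt_transversal hf S p
  refine ⟨_, _, hpair, fun v w z => ?_⟩
  have hfd : MDifferentiableAt 𝓘(ℝ, E) 𝓘(ℝ, F) f p := hf.smooth.mdifferentiable (by simp) p
  have hφ := contDiffAt_mapInChart hf.smooth p
  have hφ1 : DifferentiableAt ℝ (fderiv ℝ (mapInChart (E := E) (F := F) f p)) (chartAt E p p) :=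
    differentiableAt_fderiv_of_contDiffAt hφ
  have hφ2 : DifferentiableAt ℝ (fderiv ℝ (fderiv ℝ (mapInChart (E := E) (F := F) f p)))
      (chartAt E p p) := differentiableAt_fderiv_of_contDiffAt (hφ.fderiv_right (by simp))
  have hφp : mapInChart (E := E) (F := F) f p (chartAt E p p) = chartAt F (f p) (f p) := by
    rw [mapInChart, (chartAt E p).left_inv (mem_chart_source E p)]
  have hG := g.contDiffAt_metricInChart (f p)
  have hs := g.eventually_metricInChart_symm (f p)
  have hi := g.isInvertible_metricInChart (f p)
  have hΓ := differentiableAt_christoffel hG hi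
  have hself := metricInChart_self (M := N) g.form (f p)
  rw [← hφp] at hG hs hi hΓ
  have hτ : DifferentiableAt ℝ (S.tangentialProjectionInChart p) (chartAt E p p) :=
    differentiableAt_tangentialProjection (b := fun x => metricInChart g.form (f p)
      (mapInChart f p x)) hφ1 hn hf.codimension_one (hev.mono fun x hx =>
        ⟨hx.1, hx.2.1, hx.2.2.1, hx.2.2.2⟩)
  have hΓ' : DifferentiableAt ℝ (S.inducedChristoffel p) (chartAt E p p) := by
    have h1 : DifferentiableAt ℝ (fun x => christoffel (metricInChart g.form (f p))
        (mapInChart (E := E) f p x)) (chartAt E p p) :=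
      DifferentiableAt.comp (g := christoffel (metricInChart g.form (f p))) (chartAt E p p) hΓ
        (hφ.differentiableAt (by simp))
    have h2 := hφ2.add (differentiableAt_bilinearComp h1 hφ1)
    exact ((ContinuousLinearMap.compL ℝ E F E).differentiableAt.comp _ hτ).clm_comp h2
  have key := gauss_equation hφ hG hs hi hn (hev.mono fun x hx => hx.2.2.1.null) hΓ' (by
    filter_upwards [hev] with x ⟨hb, hinj, hp, h1, h2⟩ v w
    obtain ⟨a, β, ha⟩ := hp.exists_eq_add hb hinj hf.codimension_one
      (fderiv ℝ (fderiv ℝ (mapInChart f p)) x v w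
        + christoffel (metricInChart g.form (f p)) (mapInChart f p x)
          (fderiv ℝ (mapInChart f p) x v) (fderiv ℝ (mapInChart f p) x w))
    refine ⟨β, ?_⟩
    have h3 : S.inducedChristoffel p x v w = S.tangentialProjectionInChart p x
        (fderiv ℝ (fderiv ℝ (mapInChart f p)) x v w
        + christoffel (metricInChart g.form (f p)) (mapInChart f p x)
          (fderiv ℝ (mapInChart f p) x v) (fderiv ℝ (mapInChart f p) x w)) := rfl
    rw [h3, ha, map_add, map_smul, h1, h2, smul_zero, add_zero]) v w z
  have hd : ∀ v : E, fderiv ℝ (mapInChart (E := E) (F := F) f p) (chartAt E p p) v =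
      (mfderiv 𝓘(ℝ, E) 𝓘(ℝ, F) f p v : F) := fderiv_mapInChart_self p hfd
  rw [hs.self_of_nhds, hφp, hd, hd, hd, hd] at key
  exact key.trans (hself _ _)

end EinsteinHypersurface

end LightlikeGeometry

end


theorem corollary4p4
    {E : Type*} [NormedAddCommGroup E] [NormedSpace ℝ E] [FiniteDimensional ℝ E]
    {F : Type*} [NormedAddCommGroup F] [NormedSpace ℝ F] [FiniteDimensional ℝ F]
    {M : Type*} [TopologicalSpace M] [ChartedSpace E M] [IsManifold 𝓘(ℝ, E) ∞ M]
    {N : Type*} [TopologicalSpace N] [ChartedSpace F N] [IsManifold 𝓘(ℝ, F) ∞ N]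
    (g : LightlikeGeometry.SemiRiemannianMetric F N) (c : ℝ)
    (hc : g.HasConstantSectionalCurvature c)
    (f : M → N) (hf : LightlikeGeometry.IsLightlikeHypersurface (E := E) g f)
    (u : M) (hu : LightlikeGeometry.IsOssermanAt (E := E) g f u)
    (S : LightlikeGeometry.ScreenDistribution (E := E) g f) (hS : S.IsAdmissible) :
    S.IsEinsteinAt u := by
  obtain ⟨ξ, n, hp, hgauss⟩ := LightlikeGeometry.form_inducedCurvature hf S u
  let b : E →L[ℝ] E →L[ℝ] ℝ := LightlikeGeometry.inducedMetric (E := E) g f u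
  let η : E →L[ℝ] ℝ := g.form (f u) n ∘L mfderiv 𝓘(ℝ, E) 𝓘(ℝ, F) f u
  let R : E →L[ℝ] E →L[ℝ] E →L[ℝ] E := S.inducedCurvature u
  have hp' := LightlikeGeometry.ScreenDistribution.isNormalizingPair_iff.1 hp
  -- In `c (ḡ(ξ, y) ḡ(x, n) - ḡ(x, y) ḡ(ξ, n))` the first product vanishes since `ξ` is radical, and
  -- `ḡ(ξ, n) = 1`.
  have hηR : ∀ x y, η (R x ξ y) = -c * b x y := by
    intro x y
    refine (hgauss x ξ y).symm.trans ?_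
    refine (LightlikeGeometry.SemiRiemannianMetric.form_riemann_eq hc hp'.null hp'.normalized
      (hp'.mem_radical ξ) _ _ _ _).trans ?_
    have h1 : g.form (f u) (mfderiv 𝓘(ℝ, E) 𝓘(ℝ, F) f u ξ) (mfderiv 𝓘(ℝ, E) 𝓘(ℝ, F) f u y) = 0 :=
      hp'.mem_radical y
    have h2 : g.form (f u) (mfderiv 𝓘(ℝ, E) 𝓘(ℝ, F) f u ξ) n = 1 :=
      (g.symm _ _ _).trans hp'.normalized
    have h3 : g.form (f u) (mfderiv 𝓘(ℝ, E) 𝓘(ℝ, F) f u x) (mfderiv 𝓘(ℝ, E) 𝓘(ℝ, F) f u y) =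
      b x y := rfl
    erw [h1, h2, h3]
    ring
  have main : ∀ ε : ℝ, ε ^ 2 = 1 → (LightlikeGeometry.pseudoSphere (E := E) g f u ε).Nonempty →
      LightlikeGeometry.IsOssermanOn (E := E) g f u ε → S.IsEinsteinAt u := by
    rintro ε hε ⟨x₀, hx₀⟩ hO
    exact LightlikeGeometry.exists_ricci_eq (b := b) (η := η) (ξ := ξ) (R := R)
      (fun x y => g.symm _ _ _) hp.mem_radical hp.normalized (hf.finrank_radical u) (hS u)
      (fun x y z => LightlikeGeometry.curvature_skew _ _ _ _ _) hηR hε hx₀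
      (fun x y hx hy => hO S hS ξ n hp x hx y hy)
  rcases hu with ⟨hne, hO⟩ | ⟨hne, hO⟩ | ⟨h₁, h₂⟩
  · exact main 1 (by norm_num) hne hO
  · exact main (-1) (by norm_num) hne hO
  · exact LightlikeGeometry.isEinsteinAt_of_pseudoSphere_eq_empty hf h₁ h₂ S
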